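/- All rings are commutative with unit. For an ideal $I$ of a noetherian ring $R$ and a finitely generated $R$-module $M$ with $IM\neq M$, let $\operatorname{depth}_I M$ denote the supremum of the lengths of $M$-regular sequences contained in $I$; the depth of a noetherian local ring $(R,\mathfrak m)$ is $\operatorname{depth} R:=\operatorname{depth}_{\mathfrak m}R$. A noetherian ring $R$ is called almost Cohen–Macaulay if $\operatorname{depth}_P R=\operatorname{depth} R_P$ for every $P\in\operatorname{Spec}(R)$, and, for $n\in\mathbb N=\{0,1,2,\dots\}$, $R$ is said to have property $(C_n)$ if $\operatorname{depth} R_P\ge\min(\operatorname{ht}P,n)-1$ for every $P\in\operatorname{Spec}(R)$. A ring $A$ is quasi-excellent if it is noetherian, if for every $P\in\operatorname{Spec}(A)$ the map from $A_P$ to its $PA_P$-adic completion is regular (flat with geometrically regular fibres), and if every finitely generated $A$-algebra $B$ has an open regular locus $\{Q\in\operatorname{Spec}(B) : B_Q \text{ is a regular local ring}\}$ in $\operatorname{Spec}(B)$. **Theorem.** Let $A$ be a quasi-excellent ring and let $k\in\mathbb N$. Then the sets $$C_k(A)=\{Q\in\operatorname{Spec}(A) : A_Q \text{ has property } (C_k)\}\quad\text{and}\quad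 \mathrm{aCM}(A)=\{Q\in\operatorname{Spec}(A) : A_Q\text{ is almost Cohen–Macaulay}\}$$ are open in the Zariski topology of $\operatorname{Spec}(A)$. -/

import Mathlib

open scoped TensorProduct

universe u

/-- `depth_I(M)`: the supremum of the lengths of the `M`-regular sequences with all entries in `I`.
(It is used only when `M` is finitely generated over a noetherian ring and `I M ≠ M`.) -/
noncomputable def idealDepth {R : Type*} [CommRing R] (I : Ideal R)
    (M : Type*) [AddCommGroup M] [Module R M] : ℕ∞ :=
  ⨆ rs ∈ {rs : List R | (∀ r ∈ rs, r ∈ I) ∧ RingTheory.Sequence.IsRegular M rs},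
    (rs.length : ℕ∞)

/-- The depth of a local ring: its depth as a module over itself in the maximal ideal. -/
noncomputable def localDepth (R : Type*) [CommRing R] [IsLocalRing R] : ℕ∞ :=
  idealDepth (IsLocalRing.maximalIdeal R) R

/-- A (noetherian) ring `R` is almost Cohen-Macaulay if `depth_P R = depth R_P`
for every prime ideal `P`. -/
def IsAlmostCohenMacaulayRing (R : Type*) [CommRing R] : Prop :=
  ∀ (P : Ideal R) [P.IsPrime], idealDepth P R = localDepth (Localization.AtPrime P)

/-- A (noetherian) ring `R` has the property `(C_n)` if `depth R_P ≥ min (ht P, n) - 1`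
for every prime ideal `P`. The `1` is moved to the other side, so nothing is truncated. -/
def HasPropertyC (n : ℕ) (R : Type*) [CommRing R] : Prop :=
  ∀ (P : Ideal R) [P.IsPrime],
    min P.height (n : ℕ∞) ≤ localDepth (Localization.AtPrime P) + 1

/-- The `(C_k)`-locus: the primes `Q` such that `R_Q` has the property `(C_k)`. -/
def propertyCLocus (k : ℕ) (R : Type*) [CommRing R] : Set (PrimeSpectrum R) :=
  {Q | HasPropertyC k (Localization.AtPrime Q.asIdeal)}

/-- The almost Cohen-Macaulay locus: the primes `Q` such that `R_Q` is almost Cohen-Macaulay. -/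
def almostCohenMacaulayLocus (R : Type*) [CommRing R] : Set (PrimeSpectrum R) :=
  {Q | IsAlmostCohenMacaulayRing (Localization.AtPrime Q.asIdeal)}

/-- The regular locus: the primes `Q` such that `R_Q` is a regular local ring. -/
def regularLocus (R : Type*) [CommRing R] : Set (PrimeSpectrum R) :=
  {Q | IsRegularLocalRing (Localization.AtPrime Q.asIdeal)}

/-- A `K`-algebra `S` is geometrically regular if `L ⊗_K S` is a (noetherian) regular ring
for every finite field extension `L` of `K`. -/
def IsGeometricallyRegular (K S : Type u) [Field K] [CommRing S] [Algebra K S] : Prop :=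
  ∀ (L : Type u) [Field L] [Algebra K L], Module.Finite K L → IsRegularRing (L ⊗[K] S)

/-- `R → S` is a regular homomorphism: it is flat with geometrically regular fibres. -/
def IsRegularHom (R S : Type u) [CommRing R] [CommRing S] [Algebra R S] : Prop :=
  Module.Flat R S ∧
    ∀ (q : Ideal R) [q.IsPrime], IsGeometricallyRegular q.ResidueField (q.ResidueField ⊗[R] S)

/-- A quasi-excellent ring: a noetherian ring `R` which is a G-ring (for every prime `P`,
the completion map `R_P → (R_P)^` is regular) and J-2 (every `R`-algebra of finite type has
an open regular locus). -/
class IsQuasiExcellentRing (R : Type u) [CommRing R] : Prop extends IsNoetherianRing R where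
  isRegularHom_completion : ∀ (P : Ideal R) [P.IsPrime],
    IsRegularHom (Localization.AtPrime P)
      (AdicCompletion (IsLocalRing.maximalIdeal (Localization.AtPrime P)) (Localization.AtPrime P))
  isOpen_regularLocus : ∀ (B : Type u) [CommRing B] [Algebra R B],
    Algebra.FiniteType R B → IsOpen (regularLocus B)

/-! Call ht Q − depth A_Q the codepth of Q. Everything reduces to showing that each locus {codepth ≤
n} is open.

This locus is stable under generalization (`height_le_localDepth_add_of_height_maximalIdeal_le`), so
by Nagata's criterion it is enough to control the points Q of V(P) near a point P of the locus. For
these, depth A_Q ≥ depth A_P + depth (A/P)_Q (`exists_notMem_forall_depthGEAt_add`) and ht Q ≤ ht P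
+ ht(Q/P) (`Ideal.exists_notMem_forall_height_le`). The domain A/P is of finite type over A, so its
regular locus is open, and it contains the generic point. Near P the ring (A/P)_Q is therefore
regular, its depth equals ht(Q/P), and subtracting the two estimates shows that the codepth of Q is
at most that of P.

A noetherian local ring is almost Cohen–Macaulay exactly when its codepth is at most one
(`isAlmostCohenMacaulayRing_iff_height_maximalIdeal_le`), so aCM(A) is the locus n = 1.

For (C_k), quasi-compactness bounds the codepth on Spec A. Any violation of the inequality at a
prime already occurs at a generic point of a component of some {codepth > n}. There are finitely
many such points for the relevant n, and the complement of C_k(A) is the union of the closures of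
those that violate it. -/

open RingTheory.Sequence Pointwise CategoryTheory Abelian IsLocalRing

/-! ### Depth bounds by weakly regular sequences -/

/-- There is a weakly `M`-regular sequence of length `n` with all entries in `I`. For a finitely
generated module over a noetherian ring this says that the `I`-depth of `M` is at least `n`, where
the depth is infinite if `I M = M`. -/
def DepthGE {R : Type*} [CommRing R] (I : Ideal R) (M : Type*) [AddCommGroup M] [Module R M]
    (n : ℕ) : Prop :=
  ∃ rs : List R, rs.length = n ∧ (∀ r ∈ rs, r ∈ I) ∧ IsWeaklyRegular M rs

namespace DepthGE

section Basic

variable {R : Type*} [CommRing R] {I J : Ideal R} {M : Type*} [AddCommGroup M] [Module R M]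

variable (I M) in
lemma zero : DepthGE I M 0 := ⟨[], rfl, by simp, .nil R M⟩

lemma succ_iff {n : ℕ} :
    DepthGE I M (n + 1) ↔ ∃ x ∈ I, IsSMulRegular M x ∧ DepthGE I (QuotSMulTop x M) n := by
  constructor
  · rintro ⟨_ | ⟨x, rs⟩, hl, hI, hr⟩
    · simp at hl
    · rw [isWeaklyRegular_cons_iff] at hr
      exact ⟨x, hI x (by simp), hr.1, rs, by simpa using hl,
        fun r h ↦ hI r (List.mem_cons_of_mem _ h), hr.2⟩
  · rintro ⟨x, hx, hreg, rs, hl, hI, hr⟩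
    exact ⟨x :: rs, by simp [hl], by simpa [hx] using hI, hr.cons hreg⟩

lemma mono {m n : ℕ} (h : DepthGE I M n) (hmn : m ≤ n) : DepthGE I M m := by
  obtain ⟨rs, rfl, hI, hr⟩ := h
  refine ⟨rs.take m, by simpa using hmn, fun r h ↦ hI r (List.mem_of_mem_take h), ?_⟩
  rw [← List.take_append_drop m rs, isWeaklyRegular_append_iff] at hr
  exact hr.1

lemma mono_ideal {n : ℕ} (h : DepthGE I M n) (hIJ : I ≤ J) : DepthGE J M n := by
  obtain ⟨rs, hl, hI, hr⟩ := h
  exact ⟨rs, hl, fun r h ↦ hIJ (hI r h), hr⟩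

variable (I M) in
lemma of_subsingleton [Subsingleton M] (n : ℕ) : DepthGE I M n := by
  induction n generalizing M with
  | zero => exact zero I M
  | succ n ih =>
    exact succ_iff.2 ⟨0, I.zero_mem, fun _ _ _ ↦ Subsingleton.elim _ _, ih _⟩

end Basic

/-- Transport of depth bounds along a ring homomorphism such that, up to units, every
element of the ideal `J` of the target comes from the ideal `I` of the source. -/
lemma iff_of_addEquiv {R S : Type*} [CommRing R] [CommRing S] (φ : R →+* S) {I : Ideal R}
    {J : Ideal S} (hI : ∀ x ∈ I, φ x ∈ J) (hJ : ∀ y ∈ J, ∃ x ∈ I, ∃ u : S, IsUnit u ∧ y = u * φ x)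
    {M N : Type*} [AddCommGroup M] [AddCommGroup N] [Module R M] [Module S N] (e : M ≃+ N)
    (he : ∀ (r : R) (m : M), e (r • m) = φ r • e m) {n : ℕ} :
    DepthGE I M n ↔ DepthGE J N n := by
  induction n generalizing M N with
  | zero => exact ⟨fun _ ↦ zero J N, fun _ ↦ zero I M⟩
  | succ n ih =>
    have key (x : R) (u : S) (hu : IsUnit u) :
        (IsSMulRegular M x ∧ DepthGE I (QuotSMulTop x M) n) ↔
        (IsSMulRegular N (u * φ x) ∧ DepthGE J (QuotSMulTop (u * φ x) N) n) := by
      have hmap : (x • (⊤ : Submodule R M)).toAddSubgroup.map (e : M →+ N) =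
          ((u * φ x) • (⊤ : Submodule S N)).toAddSubgroup := by
        obtain ⟨u, rfl⟩ := hu
        ext y
        simp only [AddSubgroup.mem_map, Submodule.mem_toAddSubgroup,
          Submodule.mem_smul_pointwise_iff_exists, Submodule.mem_top, true_and]
        constructor
        · rintro ⟨_, ⟨m, rfl⟩, rfl⟩
          refine ⟨u⁻¹ • e m, ?_⟩
          simp only [Units.smul_def, smul_smul, AddMonoidHom.coe_coe, he]
          rw [mul_right_comm, Units.mul_inv, one_mul]
        · rintro ⟨m, rfl⟩
          refine ⟨_, ⟨e.symm ((u : S) • m), rfl⟩, ?_⟩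
          simp [he, smul_smul, mul_comm]
      refine and_congr ?_ (ih (QuotientAddGroup.congr _ _ e hmap) fun r m ↦ ?_)
      · have h1 : IsSMulRegular N (u * φ x) ↔ IsSMulRegular N (φ x) :=
          ⟨fun h ↦ h.of_mul, fun h ↦ (hu.isSMulRegular N).mul h⟩
        rw [h1]
        constructor
        · intro h a b hab
          apply e.symm.injective
          apply h
          apply e.injective
          simpa [he] using hab
        · intro h a b hab
          apply e.injective
          apply h
          simpa [he] using congrArg e hab
      · obtain ⟨m, rfl⟩ := Submodule.Quotient.mk_surjective _ m
        exact congrArg (Submodule.Quotient.mk (p := (u * φ x) • (⊤ : Submodule S N))) (he r m)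
    rw [succ_iff, succ_iff]
    constructor
    · rintro ⟨x, hx, h⟩
      exact ⟨1 * φ x, by simpa using hI x hx, (key x 1 isUnit_one).1 h⟩
    · rintro ⟨y, hy, h⟩
      obtain ⟨x, hx, u, hu, rfl⟩ := hJ y hy
      exact ⟨x, hx, (key x u hu).2 h⟩

lemma congr {R : Type*} [CommRing R] {I : Ideal R} {M N : Type*} [AddCommGroup M] [AddCommGroup N]
    [Module R M] [Module R N] (e : M ≃ₗ[R] N) {n : ℕ} : DepthGE I M n ↔ DepthGE I N n :=
  iff_of_addEquiv (RingHom.id R) (fun _ h ↦ h) (fun y hy ↦ ⟨y, hy, 1, isUnit_one, by simp⟩)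
    e.toAddEquiv (by simp)

end DepthGE

/-! ### Rees' theorem and its consequences over a local ring -/

namespace DepthGE

variable {R : Type u} [CommRing R] [IsLocalRing R] [IsNoetherianRing R] {I : Ideal R}

/-- Rees' theorem over a local ring. -/
lemma iff_ext (hI : I ≤ maximalIdeal R) (M : Type u) [AddCommGroup M] [Module R M]
    [Module.Finite R M] (n : ℕ) :
    DepthGE I M n ↔
      ∀ i < n, Subsingleton (Ext (ModuleCat.of R (R ⧸ I)) (ModuleCat.of R M) i) := by
  -- The zero module is set apart because Nakayama gives `I M ≠ M` only for nonzero `M`.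
  cases subsingleton_or_nontrivial M
  · refine iff_of_true (of_subsingleton I M n) fun i _ ↦ ?_
    have h0 : Limits.IsZero (ModuleCat.of R M) := ModuleCat.isZero_of_subsingleton _
    refine ⟨fun a b ↦ ?_⟩
    rw [← a.comp_mk₀_id, ← b.comp_mk₀_id, h0.eq_of_src (𝟙 (ModuleCat.of R M)) 0]
    simp
  have hlt : I • (⊤ : Submodule R M) < ⊤ :=
    (Submodule.top_ne_ideal_smul_of_le_jacobson_annihilator
      (hI.trans (maximalIdeal_le_jacobson _))).symm.lt_top
  have hsupp : Module.support R (R ⧸ I) = PrimeSpectrum.zeroLocus I := by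
    rw [Module.support_eq_zeroLocus, Ideal.annihilator_quotient]
  constructor
  · rintro ⟨rs, rfl, hmem, hreg⟩
    have : IsRegular M rs := .of_isWeaklyRegular_of_mem_maximalIdeal M (fun r h ↦ hI (hmem r h)) hreg
    exact ModuleCat.subsingleton_ext_of_exists_isRegular I (ModuleCat.of R (R ⧸ I)) hsupp.subset
      (ModuleCat.of R M) hlt rs hmem this
  · intro h
    obtain ⟨rs, hl, hmem, hreg⟩ := ModuleCat.exists_isRegular_of_exists_subsingleton_ext I n
      (ModuleCat.of R M) hlt (ModuleCat.of R (R ⧸ I)) hsupp h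
    exact ⟨rs, hl, hmem, hreg.toIsWeaklyRegular⟩

variable {M N P : Type u} [AddCommGroup M] [Module R M] [Module.Finite R M]
  [AddCommGroup N] [Module R N] [Module.Finite R N] [AddCommGroup P] [Module R P]
  [Module.Finite R P]

/-- The long exact sequence squeezes Ext of the middle term between two vanishing groups. -/
lemma of_exact (hI : I ≤ maximalIdeal R) {f : M →ₗ[R] N} {g : N →ₗ[R] P}
    (hf : Function.Injective f) (hfg : Function.Exact f g) (hg : Function.Surjective g) {n : ℕ}
    (hM : DepthGE I M n) (hP : DepthGE I P n) : DepthGE I N n := by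
  rw [iff_ext hI] at hM hP ⊢
  intro i hi
  have := hM i hi
  have := hP i hi
  have hS : (ModuleCat.shortComplexOfCompEqZero f g hfg.linearMap_comp_eq_zero).ShortExact :=
    { exact := ModuleCat.shortComplex_exact _ hfg
      mono_f := (ModuleCat.mono_iff_injective _).2 hf
      epi_g := (ModuleCat.epi_iff_surjective _).2 hg }
  have key (x : Ext (ModuleCat.of R (R ⧸ I)) (ModuleCat.of R N) i) : x = 0 := by
    obtain ⟨y, hy⟩ := Ext.covariant_sequence_exact₂ (ModuleCat.of R (R ⧸ I)) hS x
      (@Subsingleton.elim _ (hP i hi) _ _)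
    rw [← hy, @Subsingleton.elim _ (hM i hi) y 0, Ext.zero_comp]
  exact ⟨fun a b ↦ (key a).trans (key b).symm⟩

-- Ext in degree i of the quotient sits between Ext of `M` in degrees i and i + 1, which costs one
-- degree.
omit [IsLocalRing R] [IsNoetherianRing R] in
lemma subsingleton_ext_quotSMulTop (K M : ModuleCat.{u} R) {x : R} (hx : IsSMulRegular M x)
    {n : ℕ} (h : ∀ i < n + 1, Subsingleton (Ext K M i)) (i : ℕ) (hi : i < n) :
    Subsingleton (Ext K (ModuleCat.of R (QuotSMulTop x M)) i) := by
  have zero1 := AddCommGrpCat.isZero_of_iff_subsingleton.mpr (h i (by omega))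
  have zero2 := AddCommGrpCat.isZero_of_iff_subsingleton.mpr (h (i + 1) (by omega))
  exact AddCommGrpCat.subsingleton_of_isZero <| ShortComplex.Exact.isZero_of_both_zeros
    (Ext.covariant_sequence_exact₃' K hx.smulShortComplex_shortExact
      i (i + 1) rfl) (zero1.eq_zero_of_src _) (zero2.eq_zero_of_tgt _)

/-- The sequence witnessing the hypothesis need not begin with `x`; Rees' theorem makes the drop in
depth independent of the regular element chosen. -/
lemma quotSMulTop (hI : I ≤ maximalIdeal R) {x : R} (hx : IsSMulRegular M x) {n : ℕ}
    (h : DepthGE I M (n + 1)) : DepthGE I (QuotSMulTop x M) n :=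
  (iff_ext hI _ n).2 fun i hi ↦ subsingleton_ext_quotSMulTop (ModuleCat.of R (R ⧸ I))
    (ModuleCat.of R M) hx ((iff_ext hI M (n + 1)).1 h) i hi

end DepthGE

/-! ### Associated primes and upper bounds for depth -/

section AssociatedPrimes

variable {R : Type*} [CommRing R] [IsNoetherianRing R] {M : Type*} [AddCommGroup M] [Module R M]

lemma IsAssociatedPrime.exists_smul_eq_zero_iff {p : Ideal R} (hp : IsAssociatedPrime p M) :
    ∃ m : M, ∀ a : R, a • m = 0 ↔ a ∈ p := by
  obtain ⟨-, m, rfl⟩ := isAssociatedPrime_iff.1 hp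
  exact ⟨m, fun a ↦ by simp⟩

/-- The zero divisors on `M` form the union of the finitely many associated primes; prime avoidance
does the rest. -/
lemma exists_isAssociatedPrime_of_forall_not_isSMulRegular [Module.Finite R M] {I : Ideal R}
    (h : ∀ x ∈ I, ¬ IsSMulRegular M x) : ∃ p : Ideal R, IsAssociatedPrime p M ∧ I ≤ p := by
  have := (Ideal.subset_union_prime_finite (associatedPrimes.finite R M) (f := id) (I := I) 0 0
    fun _ h _ _ ↦ h.isPrime).1 <| by
      simp_rw [id, biUnion_associatedPrimes_eq_compl_regular R M]
      exact h
  exact this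

lemma IsAssociatedPrime.not_isSMulRegular {p : Ideal R} (hp : IsAssociatedPrime p M) {x : R}
    (hx : x ∈ p) : ¬ IsSMulRegular M x := by
  obtain ⟨m, hm⟩ := hp.exists_smul_eq_zero_iff
  intro h
  have hm0 : m = 0 := h (by simp [(hm x).2 hx])
  exact hp.isPrime.ne_top ((Ideal.eq_top_iff_one p).2 ((hm 1).1 (by simp [hm0])))

/-- Let N be the nonzero submodule of elements killed by `p`. If N were inside xM, regularity of `x`
would give N = xN, against Nakayama. So some element of N survives in the quotient, where both `p`
and `x` kill it. -/
lemma IsAssociatedPrime.exists_isAssociatedPrime_quotSMulTop [IsLocalRing R] [Module.Finite R M]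
    {p : Ideal R} (hp : IsAssociatedPrime p M) {x : R} (hx : x ∈ maximalIdeal R)
    (hreg : IsSMulRegular M x) :
    ∃ q : Ideal R, IsAssociatedPrime q (QuotSMulTop x M) ∧ p ≤ q ∧ x ∈ q := by
  obtain ⟨m, hm⟩ := hp.exists_smul_eq_zero_iff
  let N : Submodule R M := Submodule.torsionBySet R M p
  have hN {y : M} : y ∈ N ↔ ∀ a ∈ p, a • y = 0 := by
    simp [N, Submodule.mem_torsionBySet_iff]
  have hle : ¬ N ≤ x • (⊤ : Submodule R M) := by
    intro hle
    have hNx : N ≤ Ideal.span {x} • N := by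
      intro y hy
      obtain ⟨z, -, rfl⟩ := (Submodule.mem_smul_pointwise_iff_exists _ _ _).1 (hle hy)
      refine Submodule.smul_mem_smul (Ideal.mem_span_singleton_self x) (hN.2 fun a ha ↦ ?_)
      apply hreg
      simpa [smul_comm x a z] using hN.1 hy a ha
    have h0 := Submodule.eq_bot_of_le_smul_of_le_jacobson_bot _ N (IsNoetherian.noetherian N) hNx
      ((Ideal.span_singleton_le_iff_mem _).2 hx |>.trans (maximalIdeal_le_jacobson _))
    have hmN : m ∈ N := hN.2 fun a ha ↦ (hm a).2 ha
    rw [h0, Submodule.mem_bot] at hmN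
    exact hp.isPrime.ne_top ((Ideal.eq_top_iff_one p).2 ((hm 1).1 (by simp [hmN])))
  obtain ⟨y, hyN, hy⟩ := SetLike.not_le_iff_exists.1 hle
  have hy0 : (Submodule.Quotient.mk y : QuotSMulTop x M) ≠ 0 := by
    rwa [Ne, Submodule.Quotient.mk_eq_zero]
  obtain ⟨q, hq, hyq⟩ := exists_le_isAssociatedPrime_of_isNoetherianRing R _ hy0
  refine ⟨q, hq, fun a ha ↦ hyq ?_, hyq ?_⟩
  · rw [Submodule.mem_colon_singleton, ← Submodule.Quotient.mk_smul, hN.1 hyN a ha]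
    simp
  · rw [Submodule.mem_colon_singleton, ← Submodule.Quotient.mk_smul, Submodule.mem_bot,
      Submodule.Quotient.mk_eq_zero]
    exact Submodule.smul_mem_pointwise_smul _ _ _ trivial

end AssociatedPrimes

namespace DepthGE

/-- Dividing by a regular element moves an associated prime to a strictly larger one, so a regular
sequence produces a chain of primes above `p`. -/
lemma le_coheight {R : Type*} [CommRing R] [IsLocalRing R] [IsNoetherianRing R] {M : Type*}
    [AddCommGroup M] [Module R M] [Module.Finite R M] {n : ℕ}
    (h : DepthGE (maximalIdeal R) M n) (p : PrimeSpectrum R) (hp : IsAssociatedPrime p.asIdeal M) :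
    (n : ℕ∞) ≤ Order.coheight p := by
  induction n generalizing M p with
  | zero => simp
  | succ n ih =>
    obtain ⟨x, hx, hreg, h⟩ := succ_iff.1 h
    obtain ⟨q, hq, hpq, hxq⟩ := hp.exists_isAssociatedPrime_quotSMulTop hx hreg
    have hlt : p < ⟨q, hq.isPrime⟩ := lt_of_le_of_ne hpq fun e ↦
      hp.not_isSMulRegular (by rw [e]; exact hxq) hreg
    calc ((n + 1 : ℕ) : ℕ∞) ≤ Order.coheight (⟨q, hq.isPrime⟩ : PrimeSpectrum R) + 1 := by
          push_cast; gcongr; exact ih h _ hq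
      _ ≤ _ := Order.coheight_add_one_le hlt

end DepthGE

section Depth

variable {R : Type*} [CommRing R]

lemma natCast_le_idealDepth_iff [IsLocalRing R] {I : Ideal R} (hI : I ≤ maximalIdeal R) {n : ℕ} :
    (n : ℕ∞) ≤ idealDepth I R ↔ DepthGE I R n := by
  constructor
  · intro h
    cases n with
    | zero => exact .zero I R
    | succ n =>
      have h' : (n : ℕ∞) < idealDepth I R := lt_of_lt_of_le (by exact_mod_cast n.lt_succ_self) h
      obtain ⟨rs, h'⟩ := lt_iSup_iff.1 h'
      obtain ⟨⟨hmem, hreg⟩, h'⟩ := lt_iSup_iff.1 h'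
      exact DepthGE.mono ⟨rs, rfl, hmem, hreg.toIsWeaklyRegular⟩ (by exact_mod_cast h')
  · rintro ⟨rs, rfl, hmem, hreg⟩
    exact le_iSup₂_of_le rs
      ⟨hmem, .of_isWeaklyRegular_of_mem_maximalIdeal R (fun r h ↦ hI (hmem r h)) hreg⟩ le_rfl

lemma natCast_le_localDepth_iff [IsLocalRing R] {n : ℕ} :
    (n : ℕ∞) ≤ localDepth R ↔ DepthGE (maximalIdeal R) R n :=
  natCast_le_idealDepth_iff le_rfl

end Depth

/-! ### Regular local rings are domains of maximal depth -/

/-- A noetherian local ring which has a prime principal ideal generated by an element of the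
maximal ideal that lies in no minimal prime is a domain. -/
lemma isDomain_of_isPrime_span_singleton {R : Type*} [CommRing R] [IsLocalRing R]
    [IsNoetherianRing R] {x : R} (hx : x ∈ maximalIdeal R) (hmin : ∀ p ∈ minimalPrimes R, x ∉ p)
    (hp : (Ideal.span {x}).IsPrime) : IsDomain R := by
  obtain ⟨p, hpm, hpx⟩ := Ideal.exists_minimalPrimes_le (I := (⊥ : Ideal R)) (J := Ideal.span {x})
    bot_le
  have hprime := hpm.isPrime
  -- An element of the minimal prime p is some xz; since x is not in p, z is. Hence p = xp, and
  -- Nakayama gives p = 0.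
  have hle : p ≤ Ideal.span {x} • p := by
    intro y hy
    obtain ⟨z, rfl⟩ := Ideal.mem_span_singleton.1 (hpx hy)
    have hz : z ∈ p := (hprime.mem_or_mem hy).resolve_left (hmin p hpm)
    exact Ideal.mul_mem_mul (Ideal.mem_span_singleton_self x) hz
  have h0 := Submodule.eq_bot_of_le_smul_of_le_jacobson_bot _ p (IsNoetherian.noetherian p) hle
    ((Ideal.span_singleton_le_iff_mem _).2 hx |>.trans (maximalIdeal_le_jacobson _))
  exact IsDomain.of_bot_isPrime (A := R) (hbp := h0 ▸ hprime)

/-- An element of `m` outside `m ^ 2` can be completed to a minimal system of generators. -/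
lemma spanFinrank_maximalIdeal_quotient_le {R : Type*} [CommRing R] [IsLocalRing R]
    [IsNoetherianRing R] {x : R} (hx : x ∈ maximalIdeal R) (hx2 : x ∉ maximalIdeal R ^ 2)
    [IsLocalRing (R ⧸ Ideal.span {x})] {d : ℕ} (hd : (maximalIdeal R).spanFinrank = d + 1) :
    (maximalIdeal (R ⧸ Ideal.span {x})).spanFinrank ≤ d := by
  classical
  have hfg : (maximalIdeal R).FG := IsNoetherian.noetherian _
  set s := (maximalIdeal R).generators with hs
  have hsfin : s.Finite := Submodule.FG.finite_generators hfg
  have hspan : Ideal.span s = maximalIdeal R := (maximalIdeal R).span_generators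
  have hcard : s.ncard = d + 1 := by rw [← hd, Submodule.FG.generators_ncard hfg]
  have hsm : s ⊆ maximalIdeal R := hspan ▸ Ideal.subset_span
  obtain ⟨c, hc, rfl⟩ : ∃ c : R →₀ R, (c.support : Set R) ⊆ s ∧ c.sum (fun i a ↦ a • i) = x := by
    rw [← hspan] at hx
    exact (Submodule.mem_span_set (R := R)).1 hx
  set x := c.sum (fun i a ↦ a • i) with hxdef
  -- If all coefficients were nonunits, `x` would lie in the square of the maximal ideal. A
  -- generator with unit coefficient is redundant modulo `x`.
  obtain ⟨g, hg, hu⟩ : ∃ g ∈ c.support, IsUnit (c g) := by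
    by_contra! hcon
    refine hx2 (Ideal.sum_mem _ fun g hg ↦ ?_)
    rw [sq]
    exact Ideal.mul_mem_mul ((mem_maximalIdeal _).2 (hcon g hg)) (hsm (hc hg))
  let π := Ideal.Quotient.mk (Ideal.span {x})
  have hgs : g ∈ s := hc hg
  have hπg : π g ∈ Ideal.span (π '' (s \ {g})) := by
    have h0 : π x = 0 := Ideal.Quotient.eq_zero_iff_mem.2 (Ideal.mem_span_singleton_self x)
    have hsum : π (c g) * π g + ∑ i ∈ c.support.erase g, π (c i) * π i = 0 := by
      refine Eq.trans ?_ h0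
      have hx' : x = c g * g + ∑ i ∈ c.support.erase g, c i * i := by
        rw [hxdef, Finsupp.sum, ← Finset.add_sum_erase _ _ hg]
        rfl
      have := congrArg π hx'
      rw [map_add, map_mul, map_sum] at this
      simpa only [map_mul] using this.symm
    obtain ⟨v, hv⟩ := hu.map π
    have : π g = ((v⁻¹ : (R ⧸ Ideal.span {x})ˣ) : R ⧸ Ideal.span {x}) *
        - ∑ i ∈ c.support.erase g, π (c i) * π i := by
      rw [← hv] at hsum
      rw [← eq_neg_of_add_eq_zero_left hsum, ← mul_assoc, Units.inv_mul, one_mul]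
    rw [this]
    refine Ideal.mul_mem_left _ _ (neg_mem (Ideal.sum_mem _ fun i hi ↦ Ideal.mul_mem_left _ _
      (Ideal.subset_span ⟨i, ⟨hc (Finset.mem_of_mem_erase hi), ?_⟩, rfl⟩)))
    simpa using Finset.ne_of_mem_erase hi
  have hmax : maximalIdeal (R ⧸ Ideal.span {x}) = Ideal.span (π '' (s \ {g})) := by
    have h1 : maximalIdeal (R ⧸ Ideal.span {x}) = (maximalIdeal R).map π :=
      (map_maximalIdeal_of_surjective π Ideal.Quotient.mk_surjective).symm
    rw [h1, ← hspan, Ideal.map_span]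
    refine le_antisymm (Ideal.span_le.2 ?_) (Ideal.span_mono (Set.image_mono Set.sdiff_subset))
    rintro _ ⟨i, hi, rfl⟩
    by_cases hig : i = g
    · rw [hig]; exact hπg
    · exact Ideal.subset_span ⟨i, ⟨hi, by simpa using hig⟩, rfl⟩
  rw [hmax]
  calc _ ≤ (π '' (s \ {g})).ncard :=
        Submodule.spanFinrank_span_le_ncard_of_finite ((hsfin.subset Set.sdiff_subset).image _)
    _ ≤ (s \ {g}).ncard := Set.ncard_image_le (hsfin.subset Set.sdiff_subset)
    _ = d := by rw [Set.ncard_sdiff_singleton_of_mem hgs, hcard, Nat.add_sub_cancel]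

namespace DepthGE

lemma of_quotient {R : Type*} [CommRing R] [IsLocalRing R] {x : R} (hx : x ∈ maximalIdeal R)
    (hreg : IsSMulRegular R x) [IsLocalRing (R ⧸ Ideal.span {x})] {d : ℕ}
    (h : DepthGE (maximalIdeal (R ⧸ Ideal.span {x})) (R ⧸ Ideal.span {x}) d) :
    DepthGE (maximalIdeal R) R (d + 1) := by
  have h1 : maximalIdeal (R ⧸ Ideal.span {x}) =
      (maximalIdeal R).map (Ideal.Quotient.mk (Ideal.span {x})) :=
    (map_maximalIdeal_of_surjective _ Ideal.Quotient.mk_surjective).symm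
  refine succ_iff.2 ⟨x, hx, hreg, ?_⟩
  refine (iff_of_addEquiv (Ideal.Quotient.mk (Ideal.span {x})) (fun y hy ↦ ?_) (fun y hy ↦ ?_)
    (Submodule.quotEquivOfEq (x • (⊤ : Submodule R R)) (Ideal.span {x})
      (by rw [← Submodule.ideal_span_singleton_smul]; simp)).toAddEquiv (fun r m ↦ ?_)).2 h
  · rw [h1]
    exact Ideal.mem_map_of_mem _ hy
  · rw [h1, Ideal.mem_map_iff_of_surjective _ Ideal.Quotient.mk_surjective] at hy
    obtain ⟨z, hz, rfl⟩ := hy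
    exact ⟨z, hz, 1, isUnit_one, by simp⟩
  · obtain ⟨m, rfl⟩ := Submodule.Quotient.mk_surjective _ m
    rfl

end DepthGE

namespace IsRegularLocalRing

/-- The two claims need a joint induction: the quotient by a suitable `x` is again regular, hence a
domain by induction, so (x) is prime. This makes `R` a domain, and only then is `x` known to be
regular, which raises the depth by one. -/
lemma isDomain_and_depthGE (R : Type*) [CommRing R] [IsRegularLocalRing R] {d : ℕ}
    (hd : (maximalIdeal R).spanFinrank = d) : IsDomain R ∧ DepthGE (maximalIdeal R) R d := by
  induction d generalizing R with
  | zero =>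
    have hbot : maximalIdeal R = ⊥ :=
      (Submodule.spanFinrank_eq_zero_iff_eq_bot (IsNoetherian.noetherian _)).1 hd
    have : IsField R := isField_iff_maximalIdeal_eq.2 hbot
    exact ⟨this.isDomain, .zero _ _⟩
  | succ d ih =>
    have hdim : ringKrullDim R = (d + 1 : ℕ) := by
      rw [← hd, IsRegularLocalRing.spanFinrank_maximalIdeal]
    have hht : (maximalIdeal R).height = (d + 1 : ℕ) := by
      have := maximalIdeal_height_eq_ringKrullDim (R := R)
      rw [hdim] at this
      exact_mod_cast this
    -- Prime avoidance tolerates an ideal that is not prime, here the square of the maximal ideal.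
    obtain ⟨x, hx, hx'⟩ : ∃ x ∈ maximalIdeal R, ∀ p ∈ insert (maximalIdeal R ^ 2) (minimalPrimes R),
        x ∉ p := by
      by_contra! hcon
      obtain ⟨p, hp, hle⟩ := (Ideal.subset_union_prime_finite
        (((minimalPrimes.finite_of_isNoetherianRing R).insert (maximalIdeal R ^ 2)))
        (f := id) (I := maximalIdeal R) (maximalIdeal R ^ 2) (maximalIdeal R ^ 2)
        (fun i hi h _ ↦ (Set.mem_of_mem_insert_of_ne hi h).1.1)).1 (fun x hx ↦ by
          obtain ⟨p, hp, hxp⟩ := hcon x hx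
          exact Set.mem_biUnion hp hxp)
      rcases Set.mem_insert_iff.1 hp with rfl | hp
      · have h0 := Submodule.eq_bot_of_le_smul_of_le_jacobson_bot (maximalIdeal R)
          (maximalIdeal R) (IsNoetherian.noetherian _) (by rw [smul_eq_mul, ← sq]; exact hle)
          (maximalIdeal_le_jacobson _)
        rw [h0] at hd
        simp at hd
      · have h0 : p.height = 0 := by
          have := hp.1.1
          exact Ideal.height_eq_zero_iff.2 hp
        have := Ideal.height_mono (show maximalIdeal R ≤ p from hle)
        rw [h0, hht] at this
        simp at this
    have hx2 : x ∉ maximalIdeal R ^ 2 := hx' _ (Set.mem_insert _ _)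
    have hmin : ∀ p ∈ minimalPrimes R, x ∉ p := fun p hp ↦ hx' p (Set.mem_insert_of_mem _ hp)
    have : Nontrivial (R ⧸ Ideal.span {x}) := Ideal.Quotient.nontrivial_iff.2 fun h ↦
      (maximalIdeal.isMaximal R).ne_top
        (top_le_iff.1 (h ▸ (Ideal.span_singleton_le_iff_mem _).2 hx))
    have : IsLocalRing (R ⧸ Ideal.span {x}) :=
      .of_surjective' (Ideal.Quotient.mk (Ideal.span {x})) Ideal.Quotient.mk_surjective
    -- At most d generators and dimension at least d together force regularity of the quotient.
    have hle := spanFinrank_maximalIdeal_quotient_le hx hx2 hd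
    have hge : ((d : ℕ) : WithBot ℕ∞) ≤ ringKrullDim (R ⧸ Ideal.span {x}) := by
      have h := ringKrullDim_le_ringKrullDim_quotient_add_card {x}
        (by simpa [ringJacobson_eq_maximalIdeal R] using hx)
      rw [hdim] at h
      rw [Finset.coe_singleton, Finset.card_singleton] at h
      obtain ⟨e, he⟩ := WithBot.ne_bot_iff_exists.1
        (ne_bot_of_le_ne_bot (by simp) (ringKrullDim_nonneg_of_nontrivial (R := R ⧸ Ideal.span {x})))
      rw [← he] at h ⊢
      have h' : ((d : ℕ) : ℕ∞) + 1 ≤ e + 1 := by exact_mod_cast h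
      exact_mod_cast (ENat.add_le_add_iff_right (by simp)).1 h'
    have : IsRegularLocalRing (R ⧸ Ideal.span {x}) := .of_spanFinrank_maximalIdeal_le _
      (le_trans (by exact_mod_cast hle) hge)
    have heq : (maximalIdeal (R ⧸ Ideal.span {x})).spanFinrank = d := by
      refine le_antisymm hle ?_
      have := IsRegularLocalRing.spanFinrank_maximalIdeal (R := R ⧸ Ideal.span {x})
      rw [← this] at hge
      exact_mod_cast hge
    obtain ⟨hdom, hdepth⟩ := ih (R ⧸ Ideal.span {x}) heq
    have := isDomain_of_isPrime_span_singleton hx hmin ((Ideal.Quotient.isDomain_iff_prime _).1 hdom)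
    refine ⟨this, .of_quotient hx ?_ hdepth⟩
    refine (isSMulRegular_iff_right_eq_zero_of_smul).2 fun y hy ↦ ?_
    refine (mul_eq_zero.1 hy).resolve_left ?_
    rintro rfl
    exact hx2 (zero_mem _)

lemma depthGE (R : Type*) [CommRing R] [IsRegularLocalRing R] {d : ℕ}
    (hd : ringKrullDim R = d) : DepthGE (maximalIdeal R) R d := by
  refine (isDomain_and_depthGE R ?_).2
  have := IsRegularLocalRing.spanFinrank_maximalIdeal (R := R)
  rw [hd] at this
  exact_mod_cast this

end IsRegularLocalRing

/-! ### Depth of localized modules -/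

section LocalizedModule

variable {A : Type*} [CommRing A] {M : Type*} [AddCommGroup M] [Module A M]

lemma LocalizedModule.mk_eq_zero_iff {S : Submonoid A} {m : M} {s : S} :
    LocalizedModule.mk m s = 0 ↔ ∃ u ∈ S, u • m = 0 := by
  rw [← LocalizedModule.zero_mk 1, LocalizedModule.mk_eq]
  simp [Submonoid.smul_def]

lemma LocalizedModule.isSMulRegular_iff {S : Submonoid A} {x : A} :
    IsSMulRegular (LocalizedModule S M) x ↔
      ∀ m : M, x • m = 0 → ∃ u ∈ S, u • m = 0 := by
  rw [isSMulRegular_iff_right_eq_zero_of_smul]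
  constructor
  · intro h m hm
    rw [← mk_eq_zero_iff (s := 1)]
    apply h
    rw [LocalizedModule.smul'_mk, hm, LocalizedModule.zero_mk]
  · intro h y hy
    induction y with | h m s
    rw [LocalizedModule.smul'_mk, mk_eq_zero_iff] at hy
    obtain ⟨u, hu, hum⟩ := hy
    obtain ⟨v, hv, hvm⟩ := h (u • m) (by rw [smul_comm, hum])
    exact mk_eq_zero_iff.2 ⟨v * u, mul_mem hv hu, by rw [mul_smul, hvm]⟩

/-- Localization commutes with passing to the quotient by a multiple. -/
noncomputable def LocalizedModule.quotSMulTopEquiv (S : Submonoid A) (x : A) :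
    LocalizedModule S (QuotSMulTop x M) ≃ₗ[A] QuotSMulTop x (LocalizedModule S M) :=
  (LocalizedModule.equivTensorProduct S (QuotSMulTop x M)).restrictScalars A ≪≫ₗ
    QuotSMulTop.tensorQuotSMulTopEquivQuotSMulTop _ _ _ ≪≫ₗ
    QuotSMulTop.congr x ((LocalizedModule.equivTensorProduct S M).restrictScalars A).symm

lemma LocalizedModule.subsingleton_of_smul_eq_zero {S : Submonoid A} {f : A} (hf : f ∈ S)
    (h : ∀ m : M, f • m = 0) : Subsingleton (LocalizedModule S M) := by
  refine subsingleton_of_forall_eq 0 fun y ↦ ?_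
  induction y with | h m s
  exact mk_eq_zero_iff.2 ⟨f, hf, h m⟩

/-- An element which is regular on the localization of a noetherian module at a prime is regular
on the localizations at all primes near by. -/
lemma IsSMulRegular.exists_notMem_forall_localizedModule [IsNoetherian A M] {P : Ideal A}
    [P.IsPrime] {x : A} (h : IsSMulRegular (LocalizedModule.AtPrime P M) x) :
    ∃ f ∉ P, ∀ (Q : Ideal A) [Q.IsPrime], f ∉ Q → IsSMulRegular (LocalizedModule.AtPrime Q M) x := by
  rw [LocalizedModule.isSMulRegular_iff] at h
  -- The kernel of multiplication by x is finitely generated and vanishes at P, so a single element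
  -- outside P kills it.
  let K : Submodule A M := Submodule.torsionBy A M x
  have hK : (⟨P, inferInstance⟩ : PrimeSpectrum A) ∉ Module.support A K := by
    rw [Module.notMem_support_iff']
    rintro ⟨m, hm⟩
    obtain ⟨u, hu, hum⟩ := h m hm
    exact ⟨u, hu, Subtype.ext hum⟩
  rw [Module.mem_support_iff_of_finite, SetLike.not_le_iff_exists] at hK
  obtain ⟨f, hf, hfP⟩ := hK
  refine ⟨f, hfP, fun Q _ hfQ ↦ LocalizedModule.isSMulRegular_iff.2 fun m hm ↦ ⟨f, hfQ, ?_⟩⟩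
  simpa using congrArg Subtype.val (Module.mem_annihilator.1 hf ⟨m, hm⟩)

end LocalizedModule

/-- The depth bound for the localization of a module at a prime ideal. -/
abbrev DepthGEAt {A : Type*} [CommRing A] (Q : Ideal A) [Q.IsPrime] (M : Type*) [AddCommGroup M]
    [Module A M] (n : ℕ) : Prop :=
  DepthGE Q (LocalizedModule.AtPrime Q M) n

namespace DepthGEAt

section Basic

variable {A : Type*} [CommRing A] {Q : Ideal A} [Q.IsPrime]
  {M : Type*} [AddCommGroup M] [Module A M] {n : ℕ}

/-- Localization commutes with the quotient by `x`, so a regular sequence at `Q` can be chosen in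
`A` and then compared at different primes. -/
lemma succ_iff : DepthGEAt Q M (n + 1) ↔
    ∃ x ∈ Q, IsSMulRegular (LocalizedModule.AtPrime Q M) x ∧ DepthGEAt Q (QuotSMulTop x M) n := by
  rw [DepthGEAt, DepthGE.succ_iff]
  exact exists_congr fun x ↦ and_congr_right fun _ ↦ and_congr_right fun _ ↦
    (DepthGE.congr (LocalizedModule.quotSMulTopEquiv _ x)).symm

/-- Elements of the maximal ideal of a localization at a prime come, up to units, from the prime. -/
lemma exists_isUnit_mul_algebraMap (S : Type*) [CommRing S] [Algebra A S]
    [IsLocalization.AtPrime S Q] [IsLocalRing S] (y : S) (hy : y ∈ maximalIdeal S) :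
    ∃ x ∈ Q, ∃ u : S, IsUnit u ∧ y = u * algebraMap A S x := by
  obtain ⟨x, s, rfl⟩ := IsLocalization.exists_mk'_eq Q.primeCompl y
  refine ⟨x, ?_, IsLocalization.mk' S 1 s, ?_, ?_⟩
  · by_contra hx
    exact (IsLocalization.AtPrime.mk'_mem_maximal_iff S Q x s).not.2 (by simpa using hx) hy
  · exact (IsLocalization.AtPrime.isUnit_mk'_iff S Q 1 s).2 (one_mem _)
  · rw [mul_comm, IsLocalization.mul_mk'_eq_mk'_of_mul, mul_one]

/-- Depth over a ring, of a module over a localization at a prime, is depth over the localization. -/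
lemma depthGE_maximalIdeal_iff {S : Type*} [CommRing S] [Algebra A S]
    [IsLocalization.AtPrime S Q] [IsLocalRing S] {N : Type*} [AddCommGroup N] [Module A N]
    [Module S N] [IsScalarTower A S N] : DepthGE (maximalIdeal S) N n ↔ DepthGE Q N n :=
  (DepthGE.iff_of_addEquiv (algebraMap A S)
    (fun x hx ↦ (IsLocalization.AtPrime.to_map_mem_maximal_iff S Q x).2 hx)
    (exists_isUnit_mul_algebraMap S) (AddEquiv.refl N) (by simp)).symm

lemma iff_maximalIdeal : DepthGEAt Q M n ↔
    DepthGE (maximalIdeal (Localization.AtPrime Q)) (LocalizedModule.AtPrime Q M) n :=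
  depthGE_maximalIdeal_iff.symm

lemma congr {N : Type*} [AddCommGroup N] [Module A N] (e : M ≃ₗ[A] N) :
    DepthGEAt Q M n ↔ DepthGEAt Q N n :=
  DepthGE.congr ((IsLocalizedModule.mapEquiv Q.primeCompl
    (LocalizedModule.mkLinearMap Q.primeCompl M) (LocalizedModule.mkLinearMap Q.primeCompl N)
    (Localization.AtPrime Q) e).restrictScalars A)

lemma of_notMem_of_smul_eq_zero {f : A} (hf : f ∉ Q) (h : ∀ m : M, f • m = 0) :
    DepthGEAt Q M n :=
  have := LocalizedModule.subsingleton_of_smul_eq_zero (S := Q.primeCompl) hf h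
  DepthGE.of_subsingleton _ _ _

lemma iff_localization : DepthGEAt Q A n ↔
    DepthGE (maximalIdeal (Localization.AtPrime Q)) (Localization.AtPrime Q) n := by
  rw [depthGE_maximalIdeal_iff (Q := Q)]

lemma iff_localDepth : DepthGEAt Q A n ↔ (n : ℕ∞) ≤ localDepth (Localization.AtPrime Q) := by
  rw [iff_localization, natCast_le_localDepth_iff]

lemma _root_.DepthGE.depthGEAt (h : DepthGE Q M n) : DepthGEAt Q M n := by
  induction n generalizing M with
  | zero => exact .zero _ _
  | succ n ih =>
    obtain ⟨x, hx, hreg, h⟩ := DepthGE.succ_iff.1 h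
    refine succ_iff.2 ⟨x, hx, LocalizedModule.isSMulRegular_iff.2 fun m hm ↦
      ⟨1, one_mem _, ?_⟩, ih h⟩
    rw [one_smul]
    exact isSMulRegular_iff_right_eq_zero_of_smul.1 hreg m hm

end Basic

section Noetherian

variable {A : Type u} [CommRing A] [IsNoetherianRing A] {Q : Ideal A} [Q.IsPrime] {n : ℕ}
  {M N P : Type u} [AddCommGroup M] [Module A M] [Module.Finite A M]
  [AddCommGroup N] [Module A N] [Module.Finite A N] [AddCommGroup P] [Module A P]
  [Module.Finite A P]

lemma of_exact {f : M →ₗ[A] N} {g : N →ₗ[A] P} (hf : Function.Injective f)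
    (hfg : Function.Exact f g) (hg : Function.Surjective g)
    (hM : DepthGEAt Q M n) (hP : DepthGEAt Q P n) : DepthGEAt Q N n := by
  rw [iff_maximalIdeal] at hM hP ⊢
  exact DepthGE.of_exact le_rfl (f := LocalizedModule.map Q.primeCompl f)
    (g := LocalizedModule.map Q.primeCompl g)
    (LocalizedModule.map_injective _ _ hf)
    (LocalizedModule.map_exact _ _ _ hfg)
    (LocalizedModule.map_surjective _ _ hg) hM hP

lemma quotSMulTop {x : A} (hx : IsSMulRegular (LocalizedModule.AtPrime Q M) x)
    (h : DepthGEAt Q M (n + 1)) : DepthGEAt Q (QuotSMulTop x M) n := by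
  rw [iff_maximalIdeal] at h
  have hx' : IsSMulRegular (LocalizedModule.AtPrime Q M)
      (algebraMap A (Localization.AtPrime Q) x) := by
    intro a b hab
    exact hx (by simpa using hab)
  have h2 := h.quotSMulTop le_rfl hx'
  have heq : x • (⊤ : Submodule A (LocalizedModule.AtPrime Q M)) =
      (algebraMap A (Localization.AtPrime Q) x •
        (⊤ : Submodule (Localization.AtPrime Q) (LocalizedModule.AtPrime Q M))).restrictScalars A := by
    ext y
    simp [Submodule.mem_smul_pointwise_iff_exists]
  refine (DepthGE.congr (LocalizedModule.quotSMulTopEquiv _ x ≪≫ₗ Submodule.quotEquivOfEq _ _ heq ≪≫ₗ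
    Submodule.Quotient.restrictScalarsEquiv A _)).2 ((depthGE_maximalIdeal_iff (Q := Q)).1 h2)

end Noetherian

end DepthGEAt

/-! ### Generic lower bounds for depth along V(P) -/

section GenericDepth

variable {A : Type u} [CommRing A] [IsNoetherianRing A] (P : Ideal A) [P.IsPrime]

/-- Every finitely generated module has, at the points of `V(P)` near `P`, at least the depth of
`A ⧸ P`. -/
lemma exists_notMem_forall_depthGEAt_of_quotient (M : Type u) [AddCommGroup M] [Module A M]
    [Module.Finite A M] : ∃ f ∉ P, ∀ (Q : Ideal A) [Q.IsPrime], P ≤ Q → f ∉ Q →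
      ∀ s, DepthGEAt Q (A ⧸ P) s → DepthGEAt Q M s := by
  -- Noetherian induction on an ideal killing the module, combined with dévissage to the modules
  -- A/p.
  suffices H : ∀ (I : Ideal A) (M : Type u) [AddCommGroup M] [Module A M] [Module.Finite A M],
      I ≤ Module.annihilator A M → ∃ f ∉ P, ∀ (Q : Ideal A) [Q.IsPrime], P ≤ Q → f ∉ Q →
      ∀ s, DepthGEAt Q (A ⧸ P) s → DepthGEAt Q M s from H ⊥ M bot_le
  intro I
  induction I using WellFoundedGT.induction with | _ I IH
  intro M _ _ hM hIM
  induction hM using IsNoetherianRing.induction_on_isQuotientEquivQuotientPrime A with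
  | subsingleton N =>
    exact ⟨1, (Ideal.ne_top_iff_one P).1 (Ideal.IsPrime.ne_top ‹_›),
      fun Q _ _ _ s _ ↦ .of_notMem_of_smul_eq_zero (f := 1)
        ((Ideal.ne_top_iff_one Q).1 (Ideal.IsPrime.ne_top ‹_›)) fun m ↦ Subsingleton.elim _ _⟩
  | quotient N p e =>
    rw [e.annihilator_eq, Ideal.annihilator_quotient] at hIM
    suffices H : ∃ f ∉ P, ∀ (Q : Ideal A) [Q.IsPrime], P ≤ Q → f ∉ Q →
        ∀ s, DepthGEAt Q (A ⧸ P) s → DepthGEAt Q (A ⧸ p.asIdeal) s by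
      obtain ⟨f, hf, h⟩ := H
      exact ⟨f, hf, fun Q _ hPQ hfQ s hs ↦ (DepthGEAt.congr e).2 (h Q hPQ hfQ s hs)⟩
    by_cases hpP : p.asIdeal ≤ P
    · rcases hpP.eq_or_lt with heq | hlt
      · exact ⟨1, (Ideal.ne_top_iff_one P).1 (Ideal.IsPrime.ne_top ‹_›),
          fun Q _ _ _ s hs ↦ by rwa [heq]⟩
      -- An x in P outside p is regular on A/p, and the quotient is killed by an ideal strictly
      -- larger than I. The induction even yields depth s + 1, of which only s is needed.
      · obtain ⟨x, hxP, hxp⟩ := SetLike.exists_of_lt hlt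
        obtain ⟨f, hf, h⟩ := IH (p.asIdeal ⊔ Ideal.span {x})
          (lt_of_le_of_ne (hIM.trans le_sup_left) fun h ↦ hxp (hIM (h ▸
            Ideal.mem_sup_right (Ideal.mem_span_singleton_self x)))) (QuotSMulTop x (A ⧸ p.asIdeal))
          (sup_le ((Ideal.annihilator_quotient (I := p.asIdeal)).ge.trans
            ((Submodule.mkQ _).annihilator_le_of_surjective (Submodule.mkQ_surjective _)))
            ((Ideal.span_singleton_le_iff_mem _).2 (QuotSMulTop.mem_annihilator _ x)))
        refine ⟨f, hf, fun Q _ hPQ hfQ s hs ↦ DepthGE.mono (DepthGEAt.succ_iff.2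
          ⟨x, hPQ hxP, LocalizedModule.isSMulRegular_iff.2 fun m hm ↦ ⟨1, one_mem _, ?_⟩,
            h Q hPQ hfQ s hs⟩) (Nat.le_succ s)⟩
        obtain ⟨m, rfl⟩ := Ideal.Quotient.mk_surjective m
        rw [one_smul]
        rw [← Ideal.Quotient.mk_eq_mk, ← Submodule.Quotient.mk_smul, Submodule.Quotient.mk_eq_zero,
          smul_eq_mul] at hm
        exact Ideal.Quotient.eq_zero_iff_mem.2 ((p.isPrime.mem_or_mem hm).resolve_left hxp)
    -- Here A/p vanishes at all primes avoiding f.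
    · obtain ⟨f, hfp, hfP⟩ := SetLike.not_le_iff_exists.1 hpP
      refine ⟨f, hfP, fun Q _ hPQ hfQ s hs ↦ .of_notMem_of_smul_eq_zero hfQ fun m ↦ ?_⟩
      obtain ⟨m, rfl⟩ := Ideal.Quotient.mk_surjective m
      rw [← Ideal.Quotient.mk_eq_mk, ← Submodule.Quotient.mk_smul, Submodule.Quotient.mk_eq_zero]
      exact Ideal.mul_mem_right _ _ hfp
  | exact N₁ N₂ N₃ f g hf hg hfg h₁ h₃ =>
    obtain ⟨a, ha, h₁⟩ := h₁ (hIM.trans (f.annihilator_le_of_injective hf))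
    obtain ⟨b, hb, h₃⟩ := h₃ (hIM.trans (g.annihilator_le_of_surjective hg))
    refine ⟨a * b, fun h ↦ (Ideal.IsPrime.mem_or_mem ‹_› h).elim ha hb, fun Q _ hPQ hQ s hs ↦ ?_⟩
    exact .of_exact hf hfg hg (h₁ Q hPQ (fun h ↦ hQ (Ideal.mul_mem_right _ _ h)) s hs)
      (h₃ Q hPQ (fun h ↦ hQ (Ideal.mul_mem_left _ _ h)) s hs)

/-- At the points `Q` of `V(P)` near `P`, the depth of a finitely generated module `M` is at least
the sum of the depths of `M` at `P` and of `A ⧸ P` at `Q`. -/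
theorem exists_notMem_forall_depthGEAt_add (M : Type u) [AddCommGroup M] [Module A M]
    [Module.Finite A M] {n : ℕ} (hM : DepthGEAt P M n) :
    ∃ f ∉ P, ∀ (Q : Ideal A) [Q.IsPrime], P ≤ Q → f ∉ Q →
      ∀ s, DepthGEAt Q (A ⧸ P) s → DepthGEAt Q M (s + n) := by
  induction n generalizing M with
  | zero => exact exists_notMem_forall_depthGEAt_of_quotient P M
  | succ n ih =>
    -- A regular element at P lies in every Q above P and stays regular near P, so it contributes
    -- one to the depth at Q as well.
    obtain ⟨x, hxP, hx, h⟩ := DepthGEAt.succ_iff.1 hM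
    obtain ⟨a, ha, hreg⟩ := hx.exists_notMem_forall_localizedModule
    obtain ⟨b, hb, h⟩ := ih (QuotSMulTop x M) h
    refine ⟨a * b, fun h ↦ (Ideal.IsPrime.mem_or_mem ‹_› h).elim ha hb, fun Q _ hPQ hQ s hs ↦ ?_⟩
    exact DepthGEAt.succ_iff.2 ⟨x, hPQ hxP, hreg Q fun h ↦ hQ (Ideal.mul_mem_right _ _ h),
      h Q hPQ (fun h ↦ hQ (Ideal.mul_mem_left _ _ h)) s hs⟩

end GenericDepth

/-! ### Codepth of a noetherian local ring -/

section Local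

variable {R : Type u} [CommRing R] [IsLocalRing R] [IsNoetherianRing R]

/-- An element with annihilator `q` stays nonzero in the localization at `q` and is killed by all of
`q`. -/
lemma IsAssociatedPrime.not_depthGEAt_one {A M : Type*} [CommRing A] [IsNoetherianRing A]
    [AddCommGroup M] [Module A M] {q : Ideal A} [q.IsPrime] (hq : IsAssociatedPrime q M) :
    ¬ DepthGEAt q M 1 := by
  intro h
  obtain ⟨x, hx, hreg, -⟩ := DepthGEAt.succ_iff.1 h
  obtain ⟨m, hm⟩ := hq.exists_smul_eq_zero_iff
  obtain ⟨u, hu, hum⟩ := LocalizedModule.isSMulRegular_iff.1 hreg m ((hm x).2 hx)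
  exact hu ((hm u).1 hum)

/-- If `g` is the `I`-depth of `M`, then `I` is contained in a prime `q` (associated to the
quotient of `M` by a maximal regular sequence in `I`) such that the depth of `M` is at most
`g + dim (R ⧸ q)` and the depth of `M` at `q` is at most `g`. -/
lemma exists_primeSpectrum_of_not_depthGE_succ {I : Ideal R}
    {M : Type u} [AddCommGroup M] [Module R M] [Module.Finite R M] {g : ℕ}
    (hg : DepthGE I M g) (hg' : ¬ DepthGE I M (g + 1)) :
    ∃ q : PrimeSpectrum R, I ≤ q.asIdeal ∧
      (∀ n, DepthGE (maximalIdeal R) M n → (n : ℕ∞) ≤ g + Order.coheight q) ∧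
      ∀ n, DepthGEAt q.asIdeal M n → n ≤ g := by
  induction g generalizing M with
  | zero =>
    obtain ⟨q, hq, hIq⟩ := exists_isAssociatedPrime_of_forall_not_isSMulRegular (M := M) (I := I)
      fun x hx hreg ↦ hg' (DepthGE.succ_iff.2 ⟨x, hx, hreg, .zero _ _⟩)
    have := hq.isPrime
    refine ⟨⟨q, hq.isPrime⟩, hIq, fun n hn ↦ ?_, fun n hn ↦ ?_⟩
    · simpa using hn.le_coheight ⟨q, hq.isPrime⟩ hq
    · by_contra! h
      exact hq.not_depthGEAt_one (hn.mono h)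
  | succ g ih =>
    obtain ⟨x, hx, hreg, hg⟩ := DepthGE.succ_iff.1 hg
    obtain ⟨q, hIq, h1, h2⟩ := ih hg fun h ↦ hg' (DepthGE.succ_iff.2 ⟨x, hx, hreg, h⟩)
    refine ⟨q, hIq, fun n hn ↦ ?_, fun n hn ↦ ?_⟩
    · cases n with
      | zero => simp
      | succ n =>
        have := h1 n (hn.quotSMulTop le_rfl hreg)
        push_cast
        rw [add_right_comm]
        gcongr
    · cases n with
      | zero => simp
      | succ n =>
        refine Nat.succ_le_succ (h2 n (hn.quotSMulTop
          (LocalizedModule.isSMulRegular_iff.2 fun m hm ↦ ⟨1, one_mem _, ?_⟩)))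
        rw [one_smul]
        exact isSMulRegular_iff_right_eq_zero_of_smul.1 hreg m hm

omit [IsNoetherianRing R] in
lemma height_add_coheight_le_height_maximalIdeal (p : PrimeSpectrum R) :
    p.asIdeal.height + Order.coheight p ≤ (maximalIdeal R).height := by
  have h := maximalIdeal_height_eq_ringKrullDim (R := R)
  rw [ringKrullDim, Order.krullDim_eq_iSup_height_add_coheight_of_nonempty, WithBot.coe_inj] at h
  rw [h, PrimeSpectrum.height_eq_orderHeight]
  exact le_iSup (fun a : PrimeSpectrum R ↦ Order.height a + Order.coheight a) p

lemma coheight_ne_top (p : PrimeSpectrum R) : Order.coheight p ≠ ⊤ :=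
  ne_top_of_le_ne_top (Ideal.height_ne_top_of_isPrime (I := maximalIdeal R))
    (le_add_self.trans (height_add_coheight_le_height_maximalIdeal p))

lemma DepthGE.le_height_maximalIdeal {n : ℕ} (h : DepthGE (maximalIdeal R) R n) :
    (n : ℕ∞) ≤ (maximalIdeal R).height := by
  obtain ⟨p, hp⟩ := associatedPrimes.nonempty R R
  exact (h.le_coheight ⟨p, hp.isPrime⟩ hp).trans
    (le_add_self.trans (height_add_coheight_le_height_maximalIdeal _))

lemma exists_depthGE_and_not_depthGE_succ {I : Ideal R} (hI : I ≤ maximalIdeal R) :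
    ∃ g, DepthGE I R g ∧ ¬ DepthGE I R (g + 1) := by
  by_contra! h
  have hall : ∀ n, DepthGE I R n := fun n ↦ by
    induction n with
    | zero => exact .zero _ _
    | succ n ih => exact h n ih
  refine Ideal.height_ne_top_of_isPrime (I := maximalIdeal R) (ENat.eq_top_iff_forall_ge.2 fun n ↦ ?_)
  exact ((hall n).mono_ideal hI).le_height_maximalIdeal

lemma localDepth_le_height_maximalIdeal : localDepth R ≤ (maximalIdeal R).height :=
  ENat.forall_natCast_le_iff_le.1 fun _ hn ↦
    (natCast_le_localDepth_iff.1 hn).le_height_maximalIdeal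

/-- The codepth does not increase under generalization. -/
lemma height_le_localDepth_add_of_height_maximalIdeal_le {n : ℕ}
    (h : (maximalIdeal R).height ≤ localDepth R + n) (p : Ideal R) [hp : p.IsPrime] :
    p.height ≤ localDepth (Localization.AtPrime p) + n := by
  have hpm := le_maximalIdeal hp.ne_top
  -- With g the depth in p and q ⊇ p as provided, depth R ≤ g + dim R/q ≤ g + dim R/p, while g ≤
  -- depth R_p. The finite number dim R/p then cancels.
  obtain ⟨g, hg, hg'⟩ := exists_depthGE_and_not_depthGE_succ hpm
  obtain ⟨q, hpq, hq, -⟩ := exists_primeSpectrum_of_not_depthGE_succ hg hg'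
  let p' : PrimeSpectrum R := ⟨p, hp⟩
  have h1 : localDepth R ≤ g + Order.coheight p' :=
    ENat.forall_natCast_le_iff_le.1 fun n hn ↦ (hq n (natCast_le_localDepth_iff.1 hn)).trans
      (add_le_add_right (Order.coheight_anti (show p' ≤ q from hpq)) _)
  have h2 : (g : ℕ∞) ≤ localDepth (Localization.AtPrime p) := DepthGEAt.iff_localDepth.1 hg.depthGEAt
  have h3 : p.height + Order.coheight p' ≤ (g + n) + Order.coheight p' :=
    calc p.height + Order.coheight p' ≤ (maximalIdeal R).height :=
          height_add_coheight_le_height_maximalIdeal p'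
      _ ≤ (g + Order.coheight p') + n := h.trans (by gcongr)
      _ = _ := by rw [add_right_comm]
  exact ((ENat.add_le_add_iff_right (coheight_ne_top p')).1 h3).trans (by gcongr)

/-- A finitely generated module of dimension at least two over a noetherian local ring has positive
depth at some prime of its support. -/
lemma exists_mem_support_depthGEAt_one {M : Type*} [AddCommGroup M] [Module R M]
    [Module.Finite R M] (h : 2 ≤ Module.supportDim R M) :
    ∃ q ∈ Module.support R M, DepthGEAt q.asIdeal M 1 := by
  obtain ⟨l, hl⟩ := Order.le_krullDim_iff.1 (show ((2 : ℕ) : WithBot ℕ∞) ≤ _ from h)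
  have h01 : l ⟨0, by omega⟩ < l ⟨1, by omega⟩ := l.strictMono (by simp [Fin.lt_def])
  have h12 : l ⟨1, by omega⟩ < l ⟨2, by omega⟩ := l.strictMono (by simp [Fin.lt_def])
  obtain ⟨⟨p₀, hp₀⟩, hp₀'⟩ : ∃ p, p = l ⟨0, by omega⟩ := ⟨_, rfl⟩
  obtain ⟨⟨p₁, hp₁⟩, hp₁'⟩ : ∃ p, p = l ⟨1, by omega⟩ := ⟨_, rfl⟩
  obtain ⟨⟨p₂, hp₂⟩, hp₂'⟩ : ∃ p, p = l ⟨2, by omega⟩ := ⟨_, rfl⟩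
  rw [← hp₀', ← hp₁'] at h01
  rw [← hp₁', ← hp₂'] at h12
  have h01 : p₀.asIdeal < p₁.asIdeal := h01
  have h1m : p₁.asIdeal < maximalIdeal R :=
    lt_of_lt_of_le (show p₁.asIdeal < p₂.asIdeal from h12) (le_maximalIdeal p₂.isPrime.ne_top)
  -- Only the maximal ideal itself may be an associated prime containing y; a minimal prime q of p₀
  -- + (y) will be the required point.
  obtain ⟨y, hym, hy⟩ : ∃ y ∈ maximalIdeal R, ∀ p ∈ associatedPrimes R M \ {maximalIdeal R},
      y ∉ p := by
    by_contra! hcon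
    obtain ⟨p, hp, hle⟩ := (Ideal.subset_union_prime_finite
      ((associatedPrimes.finite R M).sdiff (t := {maximalIdeal R}))
      (f := id) (I := maximalIdeal R) 0 0 (fun i hi _ _ ↦ hi.1.isPrime)).1 (fun x hx ↦ by
        obtain ⟨p, hp, hxp⟩ := hcon x hx
        exact Set.mem_biUnion hp hxp)
    exact hp.2 ((maximalIdeal.isMaximal R).eq_of_le hp.1.isPrime.ne_top hle).symm
  obtain ⟨q, hq, hqm⟩ := Ideal.exists_minimalPrimes_le
    (sup_le (h01.trans h1m).le ((Ideal.span_singleton_le_iff_mem _).2 hym))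
  have hqprime := hq.isPrime
  have hp₀q : p₀.asIdeal ≤ q := le_sup_left.trans hq.1.2
  have hyq : y ∈ q := hq.1.2 (Ideal.mem_sup_right (Ideal.mem_span_singleton_self y))
  -- By Krull's principal ideal theorem q/p₀ has height at most one in R/p₀, whereas the chain
  -- through p₁ gives the maximal ideal height at least two.
  have hne : q ≠ maximalIdeal R := by
    rintro rfl
    have hle := Ideal.map_height_le_one_of_mem_minimalPrimes hq
    let π := Ideal.Quotient.mk p₀.asIdeal
    have hprime {p : Ideal R} (hp : p.IsPrime) (h : p₀.asIdeal ≤ p) : (p.map π).IsPrime :=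
      Ideal.map_isPrime_of_surjective Ideal.Quotient.mk_surjective (by rwa [Ideal.mk_ker])
    have hlt {p p' : Ideal R} (h : p₀.asIdeal ≤ p) (h' : p < p') : p.map π < p'.map π := by
      refine lt_of_le_not_ge (Ideal.map_mono h'.le) fun hle ↦ h'.not_ge ?_
      have := Ideal.comap_mono (f := π) hle
      rwa [Ideal.comap_map_of_surjective _ Ideal.Quotient.mk_surjective,
        Ideal.comap_map_of_surjective _ Ideal.Quotient.mk_surjective, ← RingHom.ker_eq_comap_bot,
        Ideal.mk_ker, sup_eq_left.2 h, sup_eq_left.2 (h.trans h'.le)] at this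
    have := hprime p₀.isPrime le_rfl
    have := hprime p₁.isPrime h01.le
    have := hprime hqprime hp₀q
    have h1 := Ideal.height_add_one_le_of_lt_of_isPrime (hlt le_rfl h01)
    have h2 := Ideal.height_add_one_le_of_lt_of_isPrime (hlt h01.le h1m)
    have h3 : (1 : ℕ∞) + 1 ≤ 1 := calc
      (1 : ℕ∞) + 1 ≤ (p₁.asIdeal.map π).height + 1 := by gcongr; exact le_add_self.trans h1
      _ ≤ 1 := h2.trans hle
    exact absurd h3 (by decide)
  refine ⟨⟨q, hqprime⟩, Module.mem_support_mono (p := p₀) hp₀q hp₀,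
    DepthGEAt.succ_iff.2 ⟨y, hyq, LocalizedModule.isSMulRegular_iff.2 fun m hm ↦ ?_, .zero _ _⟩⟩
  -- If y killed an m that is nonzero at q, a minimal prime of the annihilator of m inside q would
  -- be associated to M and contain y. It would be the maximal ideal, forcing q to be maximal.
  by_contra! hcon
  let N : Submodule R M := Submodule.span R {m}
  have hN {a : R} : a ∈ Module.annihilator R N ↔ a • m = 0 := by
    rw [← Submodule.annihilator, Submodule.mem_annihilator_span_singleton]
  obtain ⟨p, hp, hpq⟩ := Ideal.exists_minimalPrimes_le (I := Module.annihilator R N) (J := q)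
    fun a ha ↦ by_contra fun haq ↦ hcon a haq (hN.1 ha)
  have hpM : IsAssociatedPrime p M := IsAssociatedPrime.map_of_injective N.subtype
    (Module.associatedPrimes.minimalPrimes_annihilator_subset_associatedPrimes R N hp)
    N.subtype_injective
  have hpm : p = maximalIdeal R := by
    by_contra hpm
    exact hy p ⟨hpM, hpm⟩ (hp.1.2 (hN.2 hm))
  exact hne (le_antisymm hqm (hpm ▸ hpq))

/-- Dividing by a regular sequence of length `g` lowers the dimension by at most `g`, which reduces
to the case of dimension two. The prime found lies in the support of the quotient, so it contains
the sequence. -/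
lemma exists_mem_support_depthGEAt_succ {M : Type u} [AddCommGroup M] [Module R M]
    [Module.Finite R M] {g : ℕ} (hg : DepthGE (maximalIdeal R) M g)
    (h : ((g + 2 : ℕ) : WithBot ℕ∞) ≤ Module.supportDim R M) :
    ∃ q ∈ Module.support R M, DepthGEAt q.asIdeal M (g + 1) := by
  induction g generalizing M with
  | zero => exact exists_mem_support_depthGEAt_one h
  | succ g ih =>
    obtain ⟨x, hx, hreg, hg⟩ := DepthGE.succ_iff.1 hg
    have hle := h.trans (Module.supportDim_le_supportDim_quotSMulTop_succ hx)
    have hle' : ((g + 2 : ℕ) : WithBot ℕ∞) ≤ Module.supportDim R (QuotSMulTop x M) := by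
      have hbot : Module.supportDim R (QuotSMulTop x M) ≠ ⊥ := by
        intro hbot
        rw [hbot, WithBot.bot_add] at hle
        exact absurd (le_bot_iff.1 hle) (WithBot.coe_ne_bot (a := ((g + 1 + 2 : ℕ) : ℕ∞)))
      obtain ⟨e, he⟩ := WithBot.ne_bot_iff_exists.1 hbot
      rw [← he] at hle ⊢
      have h' : ((g + 2 : ℕ) : ℕ∞) + 1 ≤ e + 1 := WithBot.coe_le_coe.1 hle
      exact WithBot.coe_le_coe.2 ((ENat.add_le_add_iff_right (by simp)).1 h')
    obtain ⟨q, hq, hqd⟩ := ih hg hle'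
    rw [Module.support_quotSMulTop] at hq
    exact ⟨q, hq.1, DepthGEAt.succ_iff.2 ⟨x, by simpa using hq.2,
      LocalizedModule.isSMulRegular_iff.2 fun m hm ↦
        ⟨1, one_mem _, by rw [one_smul]; exact isSMulRegular_iff_right_eq_zero_of_smul.1 hreg m hm⟩,
      hqd⟩⟩

/-- A noetherian local ring is almost Cohen-Macaulay if and only if its codepth is at most one. -/
theorem isAlmostCohenMacaulayRing_iff_height_maximalIdeal_le :
    IsAlmostCohenMacaulayRing R ↔ (maximalIdeal R).height ≤ localDepth R + 1 := by
  constructor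
  · intro h
    -- With g the depth of R, codepth at least two yields a prime q with depth R_q ≥ g + 1. The
    -- hypothesis turns this into a regular sequence of length g + 1 inside q, a contradiction.
    obtain ⟨g, hg, hg'⟩ := exists_depthGE_and_not_depthGE_succ (le_refl (maximalIdeal R))
    by_contra! hlt
    have hle : ((g + 2 : ℕ) : ℕ∞) ≤ (maximalIdeal R).height := by
      have := (add_le_add_left (natCast_le_localDepth_iff.2 hg) 1).trans_lt hlt
      have := Order.add_one_le_of_lt this
      push_cast
      rwa [add_assoc, one_add_one_eq_two] at this
    obtain ⟨q, -, hq⟩ := exists_mem_support_depthGEAt_succ hg (by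
      rw [Module.supportDim_self_eq_ringKrullDim, ← maximalIdeal_height_eq_ringKrullDim]
      exact WithBot.coe_le_coe.2 hle)
    have hqm := le_maximalIdeal q.isPrime.ne_top
    have := DepthGEAt.iff_localDepth.1 hq
    rw [← h q.asIdeal, natCast_le_idealDepth_iff hqm] at this
    exact hg' (this.mono_ideal hqm)
  · intro h p hp
    have hpm := le_maximalIdeal hp.ne_top
    refine le_antisymm (ENat.forall_natCast_le_iff_le.1 fun n hn ↦
      DepthGEAt.iff_localDepth.1 ((natCast_le_idealDepth_iff hpm).1 hn).depthGEAt) ?_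
    obtain ⟨g, hg, hg'⟩ := exists_depthGE_and_not_depthGE_succ hpm
    obtain ⟨q, hpq, hq, hq'⟩ := exists_primeSpectrum_of_not_depthGE_succ hg hg'
    refine le_trans ?_ ((natCast_le_idealDepth_iff hpm).2 hg)
    by_contra! hlt
    have hle : (g : ℕ∞) + 1 ≤ localDepth (Localization.AtPrime p) := Order.add_one_le_of_lt hlt
    let p' : PrimeSpectrum R := ⟨p, hp⟩
    -- If q = p, the depth at p is at most g. If q is strictly larger, dim R/p ≥ dim R/q + 1, and a
    -- depth above g at p would push the codepth of R past one.
    rcases (show p' ≤ q from hpq).eq_or_lt with rfl | hlt'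
    · have := hq' (g + 1) (DepthGEAt.iff_localDepth.2 (by exact_mod_cast hle))
      omega
    · have h1 : localDepth R ≤ g + Order.coheight q :=
        ENat.forall_natCast_le_iff_le.1 fun n hn ↦ hq n (natCast_le_localDepth_iff.1 hn)
      have h2 : localDepth (Localization.AtPrime p) ≤ p.height := by
        refine localDepth_le_height_maximalIdeal.trans_eq ?_
        have := maximalIdeal_height_eq_ringKrullDim (R := Localization.AtPrime p)
        rw [IsLocalization.AtPrime.ringKrullDim_eq_height p] at this
        exact_mod_cast this
      have h3 : ((g : ℕ∞) + 1) + (Order.coheight q + 1) ≤ (g + Order.coheight q) + 1 := calc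
        _ ≤ p.height + Order.coheight p' :=
          add_le_add (hle.trans h2) (Order.coheight_add_one_le hlt')
        _ ≤ (maximalIdeal R).height := height_add_coheight_le_height_maximalIdeal p'
        _ ≤ _ := h.trans (by gcongr)
      have hc := coheight_ne_top q
      obtain ⟨c, hc⟩ := ENat.ne_top_iff_exists.1 hc
      rw [← hc] at h3
      norm_cast at h3
      omega

end Local

lemma localDepth_eq_of_ringEquiv {R S : Type*} [CommRing R] [CommRing S] [IsLocalRing R]
    [IsLocalRing S] (e : R ≃+* S) : localDepth R = localDepth S := by
  refine ENat.eq_of_forall_natCast_le_iff fun n ↦ ?_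
  rw [natCast_le_localDepth_iff, natCast_le_localDepth_iff]
  refine DepthGE.iff_of_addEquiv (e : R →+* S) (fun x hx ↦ ?_) (fun y hy ↦ ?_) e.toAddEquiv
    (by simp)
  · rw [mem_maximalIdeal, mem_nonunits_iff] at hx ⊢
    simpa using hx
  · refine ⟨e.symm y, ?_, 1, isUnit_one, by simp⟩
    rw [mem_maximalIdeal, mem_nonunits_iff] at hy ⊢
    simpa using hy

/-! ### Primes, heights and open sets in the spectrum -/

section Spec

variable {A : Type u} [CommRing A]

lemma localDepth_atPrime_comap (Q : Ideal A) [Q.IsPrime] (P : Ideal (Localization.AtPrime Q))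
    [P.IsPrime] : localDepth (Localization.AtPrime (P.comap (algebraMap A (Localization.AtPrime Q))))
      = localDepth (Localization.AtPrime P) :=
  localDepth_eq_of_ringEquiv (IsLocalization.localizationLocalizationAtPrimeIsoLocalization
    Q.primeCompl P).toRingEquiv

lemma height_maximalIdeal_localization (Q : Ideal A) [Q.IsPrime] :
    (maximalIdeal (Localization.AtPrime Q)).height = Q.height := by
  have := maximalIdeal_height_eq_ringKrullDim (R := Localization.AtPrime Q)
  rw [IsLocalization.AtPrime.ringKrullDim_eq_height Q] at this
  exact_mod_cast this

/-- Primes of the localization at `Q` are primes contained in `Q`. -/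
lemma forall_prime_localization_iff (Q : PrimeSpectrum A) (p : ℕ∞ → ℕ∞ → Prop) :
    (∀ (P : Ideal (Localization.AtPrime Q.asIdeal)) [P.IsPrime],
      p P.height (localDepth (Localization.AtPrime P))) ↔
    ∀ P ≤ Q, p P.asIdeal.height (localDepth (Localization.AtPrime P.asIdeal)) := by
  constructor
  · intro h P hPQ
    have hle : P.asIdeal ≤ Q.asIdeal := hPQ
    have hprime := Ideal.isPrime_map_of_isLocalizationAtPrime Q.asIdeal
      (S := Localization.AtPrime Q.asIdeal) hle
    have hcomap : (P.asIdeal.map (algebraMap A (Localization.AtPrime Q.asIdeal))).comap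
        (algebraMap A (Localization.AtPrime Q.asIdeal)) = P.asIdeal :=
      Ideal.under_map_of_isLocalizationAtPrime Q.asIdeal hle
    have h1 := h (P.asIdeal.map (algebraMap A (Localization.AtPrime Q.asIdeal)))
    rw [← localDepth_atPrime_comap, ← IsLocalization.height_under Q.asIdeal.primeCompl] at h1
    -- The localization depends on the ideal and its primality instance, so the equality of ideals
    -- is eliminated by substitution rather than rewritten.
    have key : ∀ (J : Ideal A) [J.IsPrime], J = P.asIdeal →
        p J.height (localDepth (Localization.AtPrime J)) →
        p P.asIdeal.height (localDepth (Localization.AtPrime P.asIdeal)) := by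
      rintro _ _ rfl h
      exact h
    exact key _ hcomap h1
  · intro h P hP
    rw [← localDepth_atPrime_comap, ← IsLocalization.height_under Q.asIdeal.primeCompl]
    refine h ⟨P.comap (algebraMap A (Localization.AtPrime Q.asIdeal)), inferInstance⟩ ?_
    exact (Ideal.comap_mono (le_maximalIdeal hP.ne_top)).trans
      (Localization.AtPrime.under_maximalIdeal (I := Q.asIdeal)).le

/-- Depth of `A ⧸ P` at a prime `Q` containing `P` is the depth of the local ring of `A ⧸ P`. -/
lemma depthGEAt_quotient_iff {P Q : Ideal A} [Q.IsPrime] (hPQ : P ≤ Q)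
    [(Q.map (Ideal.Quotient.mk P)).IsPrime] {n : ℕ} :
    DepthGEAt Q (A ⧸ P) n ↔
      DepthGE (maximalIdeal (Localization.AtPrime (Q.map (Ideal.Quotient.mk P))))
        (Localization.AtPrime (Q.map (Ideal.Quotient.mk P))) n := by
  set q := Q.map (Ideal.Quotient.mk P) with hq
  have hcomap : q.comap (Ideal.Quotient.mk P) = Q := by
    rw [hq, Ideal.comap_map_of_surjective _ Ideal.Quotient.mk_surjective,
      ← RingHom.ker_eq_comap_bot, Ideal.mk_ker, sup_eq_left.2 hPQ]
  have hmem (x : A) : Ideal.Quotient.mk P x ∈ q ↔ x ∈ Q := by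
    rw [← Ideal.mem_comap, hcomap]
  have hsub : Algebra.algebraMapSubmonoid (A ⧸ P) Q.primeCompl = q.primeCompl := by
    ext y
    obtain ⟨y, rfl⟩ := Ideal.Quotient.mk_surjective y
    constructor
    · rintro ⟨z, hz, hzy⟩ hy
      exact hz ((hmem z).1 (by rw [← Ideal.Quotient.algebraMap_eq, hzy]; exact hy))
    · intro hy
      exact ⟨y, fun h ↦ hy ((hmem y).2 h), rfl⟩
  have hloc : IsLocalizedModule Q.primeCompl
      (IsScalarTower.toAlgHom A (A ⧸ P) (Localization.AtPrime q)).toLinearMap := by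
    rw [isLocalizedModule_iff_isLocalization, hsub]
    infer_instance
  refine DepthGE.iff_of_addEquiv
    ((algebraMap (A ⧸ P) (Localization.AtPrime q)).comp (Ideal.Quotient.mk P)) (fun x hx ↦ ?_)
    (fun y hy ↦ ?_) (IsLocalizedModule.iso Q.primeCompl
      (IsScalarTower.toAlgHom A (A ⧸ P) (Localization.AtPrime q)).toLinearMap).toAddEquiv ?_
  · exact (IsLocalization.AtPrime.to_map_mem_maximal_iff _ q _).2 ((hmem x).2 hx)
  · obtain ⟨x, hx, u, hu, rfl⟩ := DepthGEAt.exists_isUnit_mul_algebraMap (Q := q) _ y hy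
    obtain ⟨x, rfl⟩ := Ideal.Quotient.mk_surjective x
    exact ⟨x, (hmem x).1 hx, u, hu, rfl⟩
  · intro r m
    refine (map_smul (IsLocalizedModule.iso Q.primeCompl
      (IsScalarTower.toAlgHom A (A ⧸ P) (Localization.AtPrime q)).toLinearMap) r m).trans ?_
    rw [Algebra.smul_def]
    rfl

variable [IsNoetherianRing A]

/-- A minimal prime over an ideal of a noetherian ring is the only one near by. -/
lemma Ideal.exists_notMem_forall_le_of_mem_minimalPrimes {I P : Ideal A} (hP : P ∈ I.minimalPrimes) :
    ∃ g ∉ P, ∀ (Q : Ideal A) [Q.IsPrime], g ∉ Q → I ≤ Q → P ≤ Q := by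
  have hfin : (I.minimalPrimes \ {P}).Finite := (Ideal.finite_minimalPrimes_of_isNoetherianRing A I).sdiff
  -- The intersection of the other minimal primes is not inside P, so it contains a g outside P.
  have hnot : ¬ hfin.toFinset.inf id ≤ P := by
    rw [hP.1.1.inf_le']
    rintro ⟨p, hp, hpP⟩
    rw [Set.Finite.mem_toFinset] at hp
    exact hp.2 (le_antisymm hpP (hP.2 hp.1.1 hpP))
  obtain ⟨g, hg, hgP⟩ := SetLike.not_le_iff_exists.1 hnot
  refine ⟨g, hgP, fun Q hQ hgQ hIQ ↦ ?_⟩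
  obtain ⟨p, hp, hpQ⟩ := Ideal.exists_minimalPrimes_le hIQ
  by_cases hpP : p = P
  · exact hpP ▸ hpQ
  · refine absurd (hpQ ?_) hgQ
    exact (Finset.inf_le (f := id) (hfin.mem_toFinset.2 ⟨hp, hpP⟩) : _ ≤ p) hg

/-- Nagata's criterion for openness in the spectrum of a noetherian ring. -/
lemma PrimeSpectrum.isOpen_of_forall_exists_notMem {U : Set (PrimeSpectrum A)}
    (hgen : ∀ P Q : PrimeSpectrum A, P ≤ Q → Q ∈ U → P ∈ U)
    (h : ∀ P ∈ U, ∃ f ∉ P.asIdeal, ∀ Q, P ≤ Q → f ∉ Q.asIdeal → Q ∈ U) : IsOpen U := by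
  rw [← isClosed_compl_iff, ← closure_subset_iff_isClosed,
    ← PrimeSpectrum.zeroLocus_vanishingIdeal_eq_closure]
  intro Q hQ hQU
  -- If Q were in U, so would be the generic point p. Points of the complement avoiding g contain p,
  -- hence must contain f; so fg vanishes on the complement and lies in p, although neither factor
  -- does.
  obtain ⟨p, hp, hpQ⟩ := Ideal.exists_minimalPrimes_le (show vanishingIdeal Uᶜ ≤ Q.asIdeal from hQ)
  obtain ⟨f, hfp, hf⟩ := h ⟨p, hp.1.1⟩ (hgen _ Q hpQ hQU)
  obtain ⟨g, hgp, hg⟩ := Ideal.exists_notMem_forall_le_of_mem_minimalPrimes hp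
  refine (hp.1.1.mem_or_mem (hp.1.2 (?_ : f * g ∈ _))).elim hfp hgp
  rw [PrimeSpectrum.mem_vanishingIdeal]
  intro z hz
  by_contra hfg
  refine hz (hf z (hg z.asIdeal (fun h ↦ hfg (Ideal.mul_mem_left _ _ h))
    fun a ha ↦ (PrimeSpectrum.mem_vanishingIdeal _ _).1 ha z hz) fun h ↦ hfg (Ideal.mul_mem_right _ _ h))

/-- At the points of `V(P)` near `P` the height is at most the sum of the height of `P` and the
relative height. -/
lemma Ideal.exists_notMem_forall_height_le (P : Ideal A) [P.IsPrime] :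
    ∃ f ∉ P, ∀ (Q : Ideal A) [Q.IsPrime], P ≤ Q → f ∉ Q →
      Q.height ≤ P.height + (Q.map (Ideal.Quotient.mk P)).height := by
  classical
  obtain ⟨s, hs, hcard⟩ := P.exists_finset_card_eq_height_of_isNoetherianRing
  obtain ⟨g, hg, h⟩ := Ideal.exists_notMem_forall_le_of_mem_minimalPrimes hs
  refine ⟨g, hg, fun Q hQ hPQ hgQ ↦ ?_⟩
  let π := Ideal.Quotient.mk P
  have hcomap {J : Ideal A} (hJ : P ≤ J) : (J.map π).comap π = J := by
    rw [Ideal.comap_map_of_surjective _ Ideal.Quotient.mk_surjective,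
      ← RingHom.ker_eq_comap_bot, Ideal.mk_ker, sup_eq_left.2 hJ]
  have hprime {J : Ideal A} (hJ : J.IsPrime) (hPJ : P ≤ J) : (J.map π).IsPrime :=
    Ideal.map_isPrime_of_surjective Ideal.Quotient.mk_surjective (by rwa [Ideal.mk_ker])
  have := hprime hQ hPQ
  obtain ⟨t, ht, htcard⟩ := (Q.map π).exists_finset_card_eq_height_of_isNoetherianRing
  let σ : A ⧸ P → A := Function.surjInv Ideal.Quotient.mk_surjective
  have hσ (y : A ⧸ P) : π (σ y) = y := Function.surjInv_eq _ y
  -- Parameters for P together with lifts of parameters for Q/P cut out Q, because away from g the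
  -- first set already forces containment of P.
  have hQmin : Q ∈ (Ideal.span ((s ∪ t.image σ : Finset A) : Set A)).minimalPrimes := by
    refine ⟨⟨hQ, Ideal.span_le.2 fun x hx ↦ ?_⟩, fun Q' ⟨hQ', hle⟩ hQ'Q ↦ ?_⟩
    · rcases Finset.mem_union.1 (Finset.mem_coe.1 hx) with hx | hx
      · exact hPQ (hs.1.2 (Ideal.subset_span hx))
      · obtain ⟨y, hy, rfl⟩ := Finset.mem_image.1 hx
        rw [SetLike.mem_coe, ← hcomap hPQ, Ideal.mem_comap, hσ]
        exact ht.1.2 (Ideal.subset_span hy)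
    · have hPQ' : P ≤ Q' := h Q' (fun hgQ' ↦ hgQ (hQ'Q hgQ')) ((Ideal.span_mono (by simp)).trans hle)
      have := ht.2 ⟨hprime hQ' hPQ', Ideal.span_le.2 fun y hy ↦ by
        rw [← hσ y]
        exact Ideal.mem_map_of_mem _ (hle (Ideal.subset_span (Finset.mem_coe.2
          (Finset.mem_union_right _ (Finset.mem_image_of_mem _ hy)))))⟩ (Ideal.map_mono hQ'Q)
      rw [← hcomap hPQ, ← hcomap hPQ']
      exact Ideal.comap_mono this
  calc Q.height ≤ (s ∪ t.image σ).card := Ideal.height_le_card_of_mem_minimalPrimes_span_finset hQmin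
    _ ≤ ((s.card + t.card : ℕ) : ℕ∞) := by
      exact_mod_cast (Finset.card_union_le _ _).trans (by gcongr; exact Finset.card_image_le)
    _ = _ := by rw [← hcard, ← htcard]; push_cast; rfl

end Spec

/-! ### Openness of the loci -/

section Locus

/-- The primes at which the codepth is at most `n`. -/
def codepthLocus (n : ℕ) (A : Type*) [CommRing A] : Set (PrimeSpectrum A) :=
  {Q | Q.asIdeal.height ≤ localDepth (Localization.AtPrime Q.asIdeal) + n}

lemma isRegularLocalRing_localization_bot (B : Type*) [CommRing B] [IsDomain B]
    [IsNoetherianRing B] : IsRegularLocalRing (Localization.AtPrime (⊥ : Ideal B)) := by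
  refine .of_spanFinrank_maximalIdeal_le _ ?_
  have : maximalIdeal (Localization.AtPrime (⊥ : Ideal B)) = ⊥ := by
    rw [← Localization.AtPrime.map_eq_maximalIdeal, Ideal.map_bot]
  rw [this, Submodule.spanFinrank_bot]
  exact ringKrullDim_nonneg_of_nontrivial

variable {A : Type u} [CommRing A]

lemma codepthLocus_mono {m n : ℕ} (h : m ≤ n) : codepthLocus m A ⊆ codepthLocus n A :=
  fun Q hQ ↦ le_trans (show Q.asIdeal.height ≤ _ from hQ) (by gcongr)

section Noetherian

variable [IsNoetherianRing A]

lemma mem_codepthLocus_of_le {n : ℕ} {P Q : PrimeSpectrum A} (hPQ : P ≤ Q)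
    (hQ : Q ∈ codepthLocus n A) : P ∈ codepthLocus n A := by
  refine (forall_prime_localization_iff Q fun a b ↦ a ≤ b + n).1 (fun p hp ↦ ?_) P hPQ
  exact height_le_localDepth_add_of_height_maximalIdeal_le
    (by rw [height_maximalIdeal_localization]; exact hQ) p

lemma localDepth_localization_ne_top (P : Ideal A) [P.IsPrime] :
    localDepth (Localization.AtPrime P) ≠ ⊤ :=
  ne_top_of_le_ne_top Ideal.height_ne_top_of_isPrime localDepth_le_height_maximalIdeal

/-- If the regular loci of the quotient domains of a noetherian ring are open, then so are the
loci of bounded codepth. -/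
theorem isOpen_codepthLocus (n : ℕ)
    (hreg : ∀ (P : Ideal A) [P.IsPrime], IsOpen (regularLocus (A ⧸ P))) :
    IsOpen (codepthLocus n A) := by
  refine PrimeSpectrum.isOpen_of_forall_exists_notMem
    (fun P Q hPQ hQ ↦ mem_codepthLocus_of_le hPQ hQ) fun P hP ↦ ?_
  -- The local ring of A/P at its generic point is a field, so the open regular locus contains a
  -- basic open neighbourhood of it.
  have hmem : (⟨⊥, Ideal.isPrime_bot⟩ : PrimeSpectrum (A ⧸ P.asIdeal)) ∈
      regularLocus (A ⧸ P.asIdeal) := isRegularLocalRing_localization_bot (A ⧸ P.asIdeal)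
  obtain ⟨_, ⟨f, rfl⟩, hf, hfsub⟩ :=
    PrimeSpectrum.isTopologicalBasis_basic_opens.exists_subset_of_mem_open hmem (hreg P.asIdeal)
  obtain ⟨f, rfl⟩ := Ideal.Quotient.mk_surjective f
  have hfP : f ∉ P.asIdeal := fun h ↦ hf (Ideal.Quotient.eq_zero_iff_mem.2 h)
  obtain ⟨d, hd⟩ := ENat.ne_top_iff_exists.1 (localDepth_localization_ne_top P.asIdeal)
  obtain ⟨a, haP, ha⟩ := exists_notMem_forall_depthGEAt_add P.asIdeal A
    (DepthGEAt.iff_localDepth.2 hd.le)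
  obtain ⟨b, hbP, hb⟩ := Ideal.exists_notMem_forall_height_le P.asIdeal
  refine ⟨f * (a * b), fun h ↦ (P.isPrime.mem_or_mem h).elim hfP fun h ↦
    (P.isPrime.mem_or_mem h).elim haP hbP, fun Q hPQ hQ ↦ ?_⟩
  have hle : P.asIdeal ≤ Q.asIdeal := hPQ
  have hfQ : f ∉ Q.asIdeal := fun h ↦ hQ (Ideal.mul_mem_right _ _ h)
  have haQ : a ∉ Q.asIdeal := fun h ↦ hQ (Ideal.mul_mem_left _ _ (Ideal.mul_mem_right _ _ h))
  have hbQ : b ∉ Q.asIdeal := fun h ↦ hQ (Ideal.mul_mem_left _ _ (Ideal.mul_mem_left _ _ h))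
  let q := Q.asIdeal.map (Ideal.Quotient.mk P.asIdeal)
  have hq : q.IsPrime := Ideal.map_isPrime_of_surjective Ideal.Quotient.mk_surjective
    (by rwa [Ideal.mk_ker])
  have hfq : Ideal.Quotient.mk P.asIdeal f ∉ q := by
    rwa [← Ideal.mem_comap, Ideal.comap_map_of_surjective _ Ideal.Quotient.mk_surjective,
      ← RingHom.ker_eq_comap_bot, Ideal.mk_ker, sup_eq_left.2 hle]
  have hqreg : IsRegularLocalRing (Localization.AtPrime q) :=
    hfsub (show (⟨q, hq⟩ : PrimeSpectrum _) ∈ _ from hfq)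
  obtain ⟨s, hs⟩ := ENat.ne_top_iff_exists.1 (Ideal.height_ne_top_of_isPrime (I := q))
  have hdepth : DepthGEAt Q.asIdeal (A ⧸ P.asIdeal) s :=
    (depthGEAt_quotient_iff hle).2 <| IsRegularLocalRing.depthGE _ <| by
      rw [IsLocalization.AtPrime.ringKrullDim_eq_height q, ← hs]
      rfl
  have h1 := DepthGEAt.iff_localDepth.1 (ha Q.asIdeal hle haQ s hdepth)
  have h2 : P.asIdeal.height ≤ localDepth (Localization.AtPrime P.asIdeal) + n := hP
  calc Q.asIdeal.height ≤ P.asIdeal.height + q.height := hb Q.asIdeal hle hbQ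
    _ ≤ (d + n) + s := by rw [hs, hd]; gcongr
    _ = ((s + d : ℕ) : ℕ∞) + n := by push_cast; ring
    _ ≤ _ := by gcongr

lemma almostCohenMacaulayLocus_eq : almostCohenMacaulayLocus A = codepthLocus 1 A := by
  ext Q
  change IsAlmostCohenMacaulayRing (Localization.AtPrime Q.asIdeal) ↔ _
  rw [isAlmostCohenMacaulayRing_iff_height_maximalIdeal_le, height_maximalIdeal_localization]
  simp [codepthLocus]

end Noetherian

lemma mem_propertyCLocus_iff {k : ℕ} {Q : PrimeSpectrum A} : Q ∈ propertyCLocus k A ↔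
    ∀ P ≤ Q, min P.asIdeal.height k ≤ localDepth (Localization.AtPrime P.asIdeal) + 1 :=
  forall_prime_localization_iff Q fun a b ↦ min a k ≤ b + 1

/-- This is the generic point of an irreducible component of `Z` through `P`; it belongs to `Z`
because `Z` is closed. -/
lemma PrimeSpectrum.exists_le_minimal_of_isClosed {Z : Set (PrimeSpectrum A)} (hZ : IsClosed Z)
    {P : PrimeSpectrum A} (hP : P ∈ Z) :
    ∃ η : PrimeSpectrum A, η.asIdeal ∈ (vanishingIdeal Z).minimalPrimes ∧ η ∈ Z ∧ η ≤ P := by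
  obtain ⟨p, hp, hpP⟩ := Ideal.exists_minimalPrimes_le
    (show vanishingIdeal Z ≤ P.asIdeal from fun a ha ↦ (mem_vanishingIdeal _ _).1 ha P hP)
  refine ⟨⟨p, hp.1.1⟩, hp, ?_, hpP⟩
  have : (⟨p, hp.1.1⟩ : PrimeSpectrum A) ∈ closure Z := by
    rw [← zeroLocus_vanishingIdeal_eq_closure]
    exact hp.1.2
  rwa [hZ.closure_eq] at this

/-- If all loci of bounded codepth of a noetherian ring are open, then so are the loci of
the properties `(C_k)`. -/
theorem isOpen_propertyCLocus [IsNoetherianRing A] (k : ℕ)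
    (hopen : ∀ n, IsOpen (codepthLocus n A)) : IsOpen (propertyCLocus k A) := by
  let bad : Set (PrimeSpectrum A) :=
    {P | localDepth (Localization.AtPrime P.asIdeal) + 1 < min P.asIdeal.height k}
  let T (n : ℕ) : Set (PrimeSpectrum A) :=
    {η | η.asIdeal ∈ (PrimeSpectrum.vanishingIdeal (codepthLocus n A)ᶜ).minimalPrimes} ∩ bad
  -- Each prime has codepth at most its finite height, so the increasing open loci cover the
  -- spectrum, and quasi-compactness selects one of them.
  obtain ⟨N, hN⟩ : ∃ N, Set.univ ⊆ codepthLocus N A := by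
    refine isCompact_univ.elim_directed_cover _ hopen (fun Q _ ↦ ?_)
      (directed_of_isDirected_le fun _ _ ↦ codepthLocus_mono)
    obtain ⟨h, hh⟩ := ENat.ne_top_iff_exists.1 (Ideal.height_ne_top_of_isPrime (I := Q.asIdeal))
    refine Set.mem_iUnion.2 ⟨h, ?_⟩
    change Q.asIdeal.height ≤ _
    rw [← hh]
    exact le_add_self
  have hcompl : (propertyCLocus k A)ᶜ =
      ⋃ n ∈ Set.Iio N, ⋃ η ∈ T n, PrimeSpectrum.zeroLocus (η.asIdeal : Set A) := by
    ext Q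
    rw [Set.mem_compl_iff, mem_propertyCLocus_iff]
    simp only [Set.mem_iUnion, not_forall, not_le, exists_prop]
    constructor
    · rintro ⟨P, hPQ, hP⟩
      obtain ⟨δ, hδ⟩ := ENat.ne_top_iff_exists.1 (localDepth_localization_ne_top P.asIdeal)
      obtain ⟨h, hh⟩ := ENat.ne_top_iff_exists.1 (Ideal.height_ne_top_of_isPrime (I := P.asIdeal))
      have hPN : P.asIdeal.height ≤ localDepth (Localization.AtPrime P.asIdeal) + N :=
        hN (Set.mem_univ P)
      obtain ⟨hP1, hP2⟩ := lt_min_iff.1 hP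
      rw [← hδ, ← hh] at hP1 hPN
      rw [← hδ] at hP2
      norm_cast at hP1 hP2 hPN
      -- A bad P has codepth n + 1 with n ≥ 1. A generic point η below P of {codepth > n} has
      -- codepth exactly n + 1, by stability under generalization. Since ht η ≤ ht P, also depth A_η
      -- ≤ depth A_P, so η is bad too.
      obtain ⟨n, rfl⟩ : ∃ n, h = δ + (n + 1) := ⟨h - δ - 1, by omega⟩
      have hPn : P ∈ (codepthLocus n A)ᶜ := by
        rw [Set.mem_compl_iff]
        change ¬ (P.asIdeal.height ≤ _)
        rw [← hδ, ← hh]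
        norm_cast
        omega
      obtain ⟨η, hη, hηn, hηP⟩ :=
        PrimeSpectrum.exists_le_minimal_of_isClosed (hopen n).isClosed_compl hPn
      have hη1 : η ∈ codepthLocus (n + 1) A := mem_codepthLocus_of_le hηP (by
        change P.asIdeal.height ≤ _
        rw [← hδ, ← hh]
        norm_cast)
      have hηh := Ideal.height_mono (show η.asIdeal ≤ P.asIdeal from hηP)
      refine ⟨n, by simp only [Set.mem_Iio]; omega, η, ⟨hη, ?_⟩, hηP.trans hPQ⟩
      obtain ⟨ε, hε⟩ := ENat.ne_top_iff_exists.1 (localDepth_localization_ne_top η.asIdeal)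
      obtain ⟨e, he⟩ := ENat.ne_top_iff_exists.1 (Ideal.height_ne_top_of_isPrime (I := η.asIdeal))
      rw [Set.mem_compl_iff] at hηn
      change ¬ (η.asIdeal.height ≤ _) at hηn
      change η.asIdeal.height ≤ _ at hη1
      change localDepth (Localization.AtPrime η.asIdeal) + 1 < min η.asIdeal.height k
      rw [← hε, ← he] at hηn hη1 ⊢
      rw [← he, ← hh] at hηh
      rw [lt_min_iff]
      norm_cast at hηn hη1 hηh ⊢
      omega
    · rintro ⟨n, -, η, ⟨-, hη⟩, hηQ⟩
      exact ⟨η, hηQ, hη⟩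
  rw [← isClosed_compl_iff, hcompl]
  refine (Set.finite_Iio N).isClosed_biUnion fun n _ ↦ ?_
  have hfin : (T n).Finite := Set.Finite.subset
    ((Ideal.finite_minimalPrimes_of_isNoetherianRing A _).preimage
      (fun _ _ _ _ h ↦ PrimeSpectrum.ext h)) Set.inter_subset_left
  exact hfin.isClosed_biUnion fun η _ ↦ PrimeSpectrum.isClosed_zeroLocus _

end Locus

theorem theorem3p7 (A : Type u) [CommRing A] [IsQuasiExcellentRing A] (k : ℕ) :
    IsOpen (propertyCLocus k A) ∧ IsOpen (almostCohenMacaulayLocus A) := by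
  have hopen (n : ℕ) : IsOpen (codepthLocus n A) := isOpen_codepthLocus n fun P _ ↦
    IsQuasiExcellentRing.isOpen_regularLocus (R := A) (A ⧸ P) inferInstance
  exact ⟨isOpen_propertyCLocus k hopen, almostCohenMacaulayLocus_eq (A := A) ▸ hopen 1⟩
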